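/- Let $d\ge 1$. A shearlet dilation group is a subgroup $H=SD$ of $\mathrm{GL}(d,\mathbb R)$, where - $S$ is a Lie subgroup of $\mathrm{GL}(d,\mathbb R)$, not necessarily Abelian, consisting of the matrices $\begin{bmatrix}1&-{}^ts\\0&B(s)\end{bmatrix}$, $s\in\mathbb R^{d-1}$, for some smooth map $B$ from $\mathbb R^{d-1}$ to the unipotent upper triangular real $(d-1)\times(d-1)$ matrices; - $D$ is the group of the diagonal matrices $a\,\mathrm{diag}(1,|a|^{\lambda_1},\dots,|a|^{\lambda_{d-1}})$, $a\in\mathbb R\setminus\{0\}$, for some fixed $(\lambda_1,\dots,\lambda_{d-1})\in\mathbb R^{d-1}$. Let $G=\mathbb R^d\rtimes H$ with product $(b_1,h_1)(b_2,h_2)=(b_1+h_1b_2,h_1h_2)$, let $\mu$ be a left Haar measure on $G$, and let $\pi$ be the quasi-regular representation of $G$ on $L^2(\mathbb R^d)$, $$\pi(b,h)f(x)=|\det h|^{-1/2}f(h^{-1}(x-b)).$$ A vector $\psi\ne 0$ in $L^2(\mathbb R^d)$ is called admissible if for every $f\in L^2(\mathbb R^d)$ the function $(b,h)\mapsto\langle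 f,\pi(b,h)\psi\rangle$ belongs to $L^2(G,\mu)$. A strongly continuous unitary representation is called square-integrable if it is irreducible and has an admissible vector. **Theorem 2.2.** For every shearlet dilation group $H$, the representation $\pi$ is square-integrable, and a vector $\psi\in L^2(\mathbb R^d)$ is admissible if and only if $$0<\int_{\mathbb R^d}\frac{|\mathcal F\psi(\xi)|^2}{|\xi_1|^d}\,d\xi<+\infty,$$ where $\mathcal F$ is the Fourier transform on $L^2(\mathbb R^d)$, given by $\mathcal Ff(\xi)=\int f(x)e^{-2\pi i\,\xi\cdot x}\,dx$ for $f\in L^1\cap L^2$. In particular, the set of admissible vectors does not depend on $H$. Moreover, for every admissible $\psi$ the map $f\mapsto\langle f,\pi(\cdot)\psi\rangle$ from $L^2(\mathbb R^d)$ to $L^2(G,\mu)$ is a positive multiple of an isometry. -/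

import Mathlib

open MeasureTheory
open scoped MatrixGroups FourierTransform ENNReal NNReal ContDiff

noncomputable section

namespace Shearlet

/-! ### Shearlet dilation groups in dimension `d = n + 1` -/

/-- Upper triangular matrices with all diagonal entries equal to `1`. -/
def IsUnipotentUpper {m : ℕ} (M : Matrix (Fin m) (Fin m) ℝ) : Prop :=
  M.BlockTriangular id ∧ ∀ i, M i i = 1

/-- The block matrix `[[1, -sᵀ], [0, B]]`. -/
def shearMatrix {n : ℕ} (s : Fin n → ℝ) (B : Matrix (Fin n) (Fin n) ℝ) :
    Matrix (Fin (n + 1)) (Fin (n + 1)) ℝ :=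
  Matrix.of (Fin.cons (Fin.cons 1 (-s)) fun i => Fin.cons 0 (B i))

/-- The diagonal matrix `a · diag(1, |a|^{l₁}, …, |a|^{lₙ})`. -/
def scalingMatrix {n : ℕ} (l : Fin n → ℝ) (a : ℝ) : Matrix (Fin (n + 1)) (Fin (n + 1)) ℝ :=
  a • Matrix.diagonal (Fin.cons 1 fun i => |a| ^ l i)

/-- `S` is a shearing subgroup: for some smooth map `B` from `ℝⁿ` to the unipotent upper triangular
matrices, `S` consists exactly of the matrices `[[1, -sᵀ], [0, B(s)]]` with `s ∈ ℝⁿ`.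
Being the graph of a smooth map on `ℝⁿ`, such a subgroup is automatically a (closed) Lie subgroup.
Smoothness of the matrix-valued map `B` is smoothness of all its entries. -/
def IsShearingSubgroup {n : ℕ} (S : Subgroup (GL (Fin (n + 1)) ℝ)) : Prop :=
  ∃ B : (Fin n → ℝ) → Matrix (Fin n) (Fin n) ℝ,
    (∀ s, IsUnipotentUpper (B s)) ∧
    (∀ i j, ContDiff ℝ ∞ fun s => B s i j) ∧
    ∀ g : GL (Fin (n + 1)) ℝ,
      g ∈ S ↔ ∃ s, (g : Matrix (Fin (n + 1)) (Fin (n + 1)) ℝ) = shearMatrix s (B s)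

/-- `D` is a scaling subgroup: for some fixed `l ∈ ℝⁿ` it consists exactly of the matrices
`a · diag(1, |a|^{l₁}, …, |a|^{lₙ})` with `a ≠ 0`. -/
def IsScalingSubgroup {n : ℕ} (D : Subgroup (GL (Fin (n + 1)) ℝ)) : Prop :=
  ∃ l : Fin n → ℝ, ∀ g : GL (Fin (n + 1)) ℝ,
    g ∈ D ↔ ∃ a : ℝ, a ≠ 0 ∧ (g : Matrix (Fin (n + 1)) (Fin (n + 1)) ℝ) = scalingMatrix l a

/-- A shearlet dilation group: a subgroup `H` of `GL(n + 1, ℝ)` of the form `H = S D`, with `S` a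
shearing subgroup (not assumed Abelian) and `D` a scaling subgroup. -/
def IsShearletDilationGroup {n : ℕ} (H : Subgroup (GL (Fin (n + 1)) ℝ)) : Prop :=
  ∃ S D : Subgroup (GL (Fin (n + 1)) ℝ), IsShearingSubgroup S ∧ IsScalingSubgroup D ∧
    ∀ h, h ∈ H ↔ ∃ σ ∈ S, ∃ δ ∈ D, h = σ * δ

/-! ### The group `ℝᵈ ⋊ H` -/

/-- The natural action `h[x]` of an invertible matrix on column vectors. -/
def act {d : ℕ} (h : GL (Fin d) ℝ) (x : EuclideanSpace ℝ (Fin d)) : EuclideanSpace ℝ (Fin d) :=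
  Matrix.toEuclideanLin (h : Matrix (Fin d) (Fin d) ℝ) x

lemma act_one {d : ℕ} (x : EuclideanSpace ℝ (Fin d)) : act 1 x = x := by
  simp [act]

lemma act_mul {d : ℕ} (h k : GL (Fin d) ℝ) (x : EuclideanSpace ℝ (Fin d)) :
    act (h * k) x = act h (act k x) := by
  simp [act, Matrix.toLpLin_apply, Matrix.mulVec_mulVec]

lemma act_add {d : ℕ} (h : GL (Fin d) ℝ) (x y : EuclideanSpace ℝ (Fin d)) :
    act h (x + y) = act h x + act h y := by
  simp [act]

lemma act_inv_act {d : ℕ} (h : GL (Fin d) ℝ) (x : EuclideanSpace ℝ (Fin d)) :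
    act h⁻¹ (act h x) = x := by
  rw [← act_mul, inv_mul_cancel, act_one]

lemma act_act_inv {d : ℕ} (h : GL (Fin d) ℝ) (x : EuclideanSpace ℝ (Fin d)) :
    act h (act h⁻¹ x) = x := by
  rw [← act_mul, mul_inv_cancel, act_one]

/-- The action of a matrix group on the additive group `ℝᵈ` by automorphisms. -/
def actHom {d : ℕ} (H : Subgroup (GL (Fin d) ℝ)) :
    H →* MulAut (Multiplicative (EuclideanSpace ℝ (Fin d))) where
  toFun h :=
    { toFun := fun b => Multiplicative.ofAdd (act h b.toAdd)
      invFun := fun b => Multiplicative.ofAdd (act (h : GL (Fin d) ℝ)⁻¹ b.toAdd)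
      left_inv := fun b => by simp [act_inv_act]
      right_inv := fun b => by simp [act_act_inv]
      map_mul' := fun b c => by simp [act_add] }
  map_one' := by ext b : 1; simp [act_one]
  map_mul' h k := by ext b : 1; simp [act_mul]

/-- The semidirect product `ℝᵈ ⋊ H`, with `(b₁, h₁)(b₂, h₂) = (b₁ + h₁[b₂], h₁ h₂)`. -/
abbrev AffineGroup {d : ℕ} (H : Subgroup (GL (Fin d) ℝ)) : Type :=
  Multiplicative (EuclideanSpace ℝ (Fin d)) ⋊[actHom H] H

/-- The translation part `b` of `(b, h)`. -/
def AffineGroup.trans {d : ℕ} {H : Subgroup (GL (Fin d) ℝ)} (g : AffineGroup H) :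
    EuclideanSpace ℝ (Fin d) := g.left.toAdd

/-- The linear part `h` of `(b, h)`. -/
def AffineGroup.lin {d : ℕ} {H : Subgroup (GL (Fin d) ℝ)} (g : AffineGroup H) :
    GL (Fin d) ℝ := (g.right : GL (Fin d) ℝ)

lemma AffineGroup.trans_mul {d : ℕ} {H : Subgroup (GL (Fin d) ℝ)} (g k : AffineGroup H) :
    AffineGroup.trans (g * k) = AffineGroup.trans g + act (AffineGroup.lin g) (AffineGroup.trans k) :=
  rfl

lemma AffineGroup.lin_mul {d : ℕ} {H : Subgroup (GL (Fin d) ℝ)} (g k : AffineGroup H) :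
    AffineGroup.lin (g * k) = AffineGroup.lin g * AffineGroup.lin k := rfl

/-- The product topology on `ℝᵈ ⋊ H`, where `H` has the topology of `GL(d, ℝ)`. -/
instance instTopologicalSpaceAffineGroup {d : ℕ} (H : Subgroup (GL (Fin d) ℝ)) :
    TopologicalSpace (AffineGroup H) :=
  TopologicalSpace.induced
    (fun g => ((AffineGroup.trans g, g.right) : EuclideanSpace ℝ (Fin d) × H)) inferInstance

instance instMeasurableSpaceAffineGroup {d : ℕ} (H : Subgroup (GL (Fin d) ℝ)) :
    MeasurableSpace (AffineGroup H) :=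
  borel (AffineGroup H)

instance instBorelSpaceAffineGroup {d : ℕ} (H : Subgroup (GL (Fin d) ℝ)) :
    BorelSpace (AffineGroup H) := ⟨rfl⟩

/-! ### The quasi-regular representation on `L²(ℝᵈ)` -/

/-- The complex Hilbert space `L²(ℝᵈ)`. -/
abbrev L2 (d : ℕ) : Type := Lp (α := EuclideanSpace ℝ (Fin d)) ℂ 2

/-- The normalizing factor `|det h|^{-1/2}`. -/
def normFactor {d : ℕ} (h : GL (Fin d) ℝ) : ℝ :=
  |(h : Matrix (Fin d) (Fin d) ℝ).det| ^ (-(1 / 2) : ℝ)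

/-- The map `x ↦ h⁻¹(x - b)` for `g = (b, h)`. -/
def invAct {d : ℕ} {H : Subgroup (GL (Fin d) ℝ)} (g : AffineGroup H)
    (x : EuclideanSpace ℝ (Fin d)) : EuclideanSpace ℝ (Fin d) :=
  act (AffineGroup.lin g)⁻¹ (x - AffineGroup.trans g)

lemma abs_det_pos {d : ℕ} (h : GL (Fin d) ℝ) : 0 < |(h : Matrix (Fin d) (Fin d) ℝ).det| :=
  abs_pos.2 (Matrix.isUnits_det_units h).ne_zero

lemma continuous_act {d : ℕ} (h : GL (Fin d) ℝ) : Continuous (act h) :=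
  (Matrix.toEuclideanLin (h : Matrix (Fin d) (Fin d) ℝ)).continuous_of_finiteDimensional

lemma map_act {d : ℕ} (h : GL (Fin d) ℝ) :
    Measure.map (act h⁻¹) (volume : Measure (EuclideanSpace ℝ (Fin d))) =
      ENNReal.ofReal |(h : Matrix (Fin d) (Fin d) ℝ).det| • volume := by
  have hdet : LinearMap.det (Matrix.toEuclideanLin ((h⁻¹ : GL (Fin d) ℝ) :
      Matrix (Fin d) (Fin d) ℝ)) = ((h : Matrix (Fin d) (Fin d) ℝ).det)⁻¹ := by
    rw [Matrix.toEuclideanLin_eq_toLin_orthonormal, LinearMap.det_toLin, Matrix.coe_units_inv,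
      Matrix.det_nonsing_inv, Ring.inverse_eq_inv]
  have h0 := (Matrix.isUnits_det_units h).ne_zero
  have := Measure.map_linearMap_addHaar_eq_smul_addHaar
    (volume : Measure (EuclideanSpace ℝ (Fin d))) (f := Matrix.toEuclideanLin
      ((h⁻¹ : GL (Fin d) ℝ) : Matrix (Fin d) (Fin d) ℝ)) (by rw [hdet]; exact inv_ne_zero h0)
  rw [hdet, inv_inv] at this
  exact this

lemma continuous_invAct {d : ℕ} {H : Subgroup (GL (Fin d) ℝ)} (g : AffineGroup H) :
    Continuous (invAct g) :=
  (continuous_act _).comp (continuous_id.sub continuous_const)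

lemma map_invAct {d : ℕ} {H : Subgroup (GL (Fin d) ℝ)} (g : AffineGroup H) :
    Measure.map (invAct g) (volume : Measure (EuclideanSpace ℝ (Fin d))) =
      ENNReal.ofReal |(AffineGroup.lin g : Matrix (Fin d) (Fin d) ℝ).det| • volume := by
  have h1 : invAct g = act (AffineGroup.lin g)⁻¹ ∘ fun x => x - AffineGroup.trans g := rfl
  rw [h1, ← Measure.map_map (continuous_act _).measurable (measurable_sub_const _),
    (measurePreserving_sub_right volume (AffineGroup.trans g)).map_eq, map_act]

lemma quasiMeasurePreserving_invAct {d : ℕ} {H : Subgroup (GL (Fin d) ℝ)} (g : AffineGroup H) :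
    Measure.QuasiMeasurePreserving (invAct g) (volume : Measure (EuclideanSpace ℝ (Fin d)))
      volume :=
  ⟨(continuous_invAct g).measurable, by
    rw [map_invAct]; exact Measure.smul_absolutelyContinuous⟩

/-- The function `x ↦ |det h|^{-1/2} f(h⁻¹(x - b))`. -/
def quasiRegularFun {d : ℕ} {H : Subgroup (GL (Fin d) ℝ)} (g : AffineGroup H)
    (f : EuclideanSpace ℝ (Fin d) → ℂ) (x : EuclideanSpace ℝ (Fin d)) : ℂ :=
  (normFactor (AffineGroup.lin g) : ℂ) * f (invAct g x)

lemma eLpNorm_quasiRegularFun {d : ℕ} {H : Subgroup (GL (Fin d) ℝ)} (g : AffineGroup H)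
    {f : EuclideanSpace ℝ (Fin d) → ℂ} (hf : AEStronglyMeasurable f volume) :
    eLpNorm (quasiRegularFun g f) 2 volume = eLpNorm f 2 volume := by
  have h1 : quasiRegularFun g f =
      (normFactor (AffineGroup.lin g) : ℂ) • (f ∘ invAct g) := rfl
  have hp := abs_det_pos (AffineGroup.lin g)
  have hm : AEStronglyMeasurable f (Measure.map (invAct g) volume) := by
    rw [map_invAct]; exact hf.smul_measure _
  rw [h1, eLpNorm_const_smul, ← eLpNorm_map_measure hm (continuous_invAct g).aemeasurable,
    map_invAct, eLpNorm_smul_measure_of_ne_top (by norm_num), smul_eq_mul, ← mul_assoc]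
  have h2 : ‖(normFactor (AffineGroup.lin g) : ℂ)‖ₑ =
      ENNReal.ofReal (|(AffineGroup.lin g : Matrix (Fin d) (Fin d) ℝ).det| ^ (-(1 / 2) : ℝ)) := by
    rw [← ofReal_norm, Complex.norm_real, normFactor, Real.norm_of_nonneg (by positivity)]
  have h3 : (1 / (2 : ℝ≥0∞)).toReal = (1 / 2 : ℝ) := by norm_num
  rw [h2, h3, ENNReal.ofReal_rpow_of_pos hp, ← ENNReal.ofReal_mul (by positivity),
    ← Real.rpow_add hp]
  norm_num

lemma memLp_quasiRegularFun {d : ℕ} {H : Subgroup (GL (Fin d) ℝ)} (g : AffineGroup H) (f : L2 d) :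
    MemLp (quasiRegularFun g f) 2 volume := by
  refine ⟨?_, ?_⟩
  · exact ((Lp.aestronglyMeasurable f).comp_quasiMeasurePreserving
      (quasiMeasurePreserving_invAct g)).const_mul _
  · rw [eLpNorm_quasiRegularFun g (Lp.aestronglyMeasurable f)]
    exact Lp.eLpNorm_lt_top f

/-- The operator `f ↦ |det h|^{-1/2} f(h⁻¹(· - b))` on `L²(ℝᵈ)`. -/
def quasiRegularOp {d : ℕ} {H : Subgroup (GL (Fin d) ℝ)} (g : AffineGroup H) (f : L2 d) : L2 d :=
  (memLp_quasiRegularFun g f).toLp _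

lemma coeFn_quasiRegularOp {d : ℕ} {H : Subgroup (GL (Fin d) ℝ)} (g : AffineGroup H) (f : L2 d) :
    quasiRegularOp g f =ᵐ[volume] quasiRegularFun g f :=
  MemLp.coeFn_toLp _

lemma quasiRegularFun_congr {d : ℕ} {H : Subgroup (GL (Fin d) ℝ)} (g : AffineGroup H)
    {f₁ f₂ : EuclideanSpace ℝ (Fin d) → ℂ} (h : f₁ =ᵐ[volume] f₂) :
    quasiRegularFun g f₁ =ᵐ[volume] quasiRegularFun g f₂ := by
  filter_upwards [(quasiMeasurePreserving_invAct g).ae_eq_comp h] with x hx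
  simp only [Function.comp_apply] at hx
  simp [quasiRegularFun, hx]

lemma quasiRegularOp_one {d : ℕ} {H : Subgroup (GL (Fin d) ℝ)} (f : L2 d) :
    quasiRegularOp (1 : AffineGroup H) f = f := by
  refine Lp.ext ((coeFn_quasiRegularOp _ f).trans (Filter.Eventually.of_forall fun x => ?_))
  have h1 : AffineGroup.lin (1 : AffineGroup H) = 1 := rfl
  have h2 : AffineGroup.trans (1 : AffineGroup H) = 0 := rfl
  simp [quasiRegularFun, normFactor, invAct, h1, h2, act_one]

lemma quasiRegularFun_mul {d : ℕ} {H : Subgroup (GL (Fin d) ℝ)} (g k : AffineGroup H)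
    (f : EuclideanSpace ℝ (Fin d) → ℂ) :
    quasiRegularFun (g * k) f = quasiRegularFun g (quasiRegularFun k f) := by
  funext x
  have h1 : invAct (g * k) x = invAct k (invAct g x) := by
    have hsub : ∀ (h : GL (Fin d) ℝ) (y z : EuclideanSpace ℝ (Fin d)),
        act h (y - z) = act h y - act h z := fun h y z => by simp [act]
    simp only [invAct, AffineGroup.lin_mul, AffineGroup.trans_mul, mul_inv_rev, act_mul, hsub,
      act_add, act_inv_act]
    abel
  have h2 : normFactor (AffineGroup.lin (g * k)) =
      normFactor (AffineGroup.lin g) * normFactor (AffineGroup.lin k) := by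
    simp only [normFactor, AffineGroup.lin_mul, Units.val_mul, Matrix.det_mul, abs_mul]
    exact Real.mul_rpow (abs_nonneg _) (abs_nonneg _)
  simp [quasiRegularFun, h1, h2, mul_assoc]

lemma quasiRegularOp_mul {d : ℕ} {H : Subgroup (GL (Fin d) ℝ)} (g k : AffineGroup H) (f : L2 d) :
    quasiRegularOp (g * k) f = quasiRegularOp g (quasiRegularOp k f) := by
  refine Lp.ext ((coeFn_quasiRegularOp _ f).trans ?_)
  rw [quasiRegularFun_mul]
  exact ((coeFn_quasiRegularOp g _).trans
    (quasiRegularFun_congr g (coeFn_quasiRegularOp k f))).symm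

lemma quasiRegularOp_add {d : ℕ} {H : Subgroup (GL (Fin d) ℝ)} (g : AffineGroup H) (f₁ f₂ : L2 d) :
    quasiRegularOp g (f₁ + f₂) = quasiRegularOp g f₁ + quasiRegularOp g f₂ := by
  refine Lp.ext ((coeFn_quasiRegularOp _ _).trans ?_)
  filter_upwards [quasiRegularFun_congr g (Lp.coeFn_add f₁ f₂), coeFn_quasiRegularOp g f₁,
    coeFn_quasiRegularOp g f₂, Lp.coeFn_add (quasiRegularOp g f₁) (quasiRegularOp g f₂)]
    with x h1 h2 h3 h4
  rw [h1, h4, Pi.add_apply, h2, h3]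
  simp [quasiRegularFun, mul_add]

lemma quasiRegularOp_smul {d : ℕ} {H : Subgroup (GL (Fin d) ℝ)} (g : AffineGroup H) (c : ℂ)
    (f : L2 d) : quasiRegularOp g (c • f) = c • quasiRegularOp g f := by
  refine Lp.ext ((coeFn_quasiRegularOp _ _).trans ?_)
  filter_upwards [quasiRegularFun_congr g (Lp.coeFn_smul c f), coeFn_quasiRegularOp g f,
    Lp.coeFn_smul c (quasiRegularOp g f)] with x h1 h2 h3
  rw [h1, h3, Pi.smul_apply, h2]
  simp [quasiRegularFun, mul_left_comm]

lemma norm_quasiRegularOp {d : ℕ} {H : Subgroup (GL (Fin d) ℝ)} (g : AffineGroup H) (f : L2 d) :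
    ‖quasiRegularOp g f‖ = ‖f‖ := by
  rw [quasiRegularOp, Lp.norm_toLp, eLpNorm_quasiRegularFun g (Lp.aestronglyMeasurable f),
    Lp.norm_def]

/-- The quasi-regular representation of `ℝᵈ ⋊ H` by unitary operators on `L²(ℝᵈ)`:
`(b, h)` acts by `f ↦ |det h|^{-1/2} f(h⁻¹(· - b))`. -/
def quasiRegular {d : ℕ} (H : Subgroup (GL (Fin d) ℝ)) :
    AffineGroup H →* (L2 d ≃ₗᵢ[ℂ] L2 d) where
  toFun g :=
    { toFun := quasiRegularOp g
      invFun := quasiRegularOp g⁻¹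
      map_add' := quasiRegularOp_add g
      map_smul' := quasiRegularOp_smul g
      left_inv := fun f => by rw [← quasiRegularOp_mul, inv_mul_cancel, quasiRegularOp_one]
      right_inv := fun f => by rw [← quasiRegularOp_mul, mul_inv_cancel, quasiRegularOp_one]
      norm_map' := norm_quasiRegularOp g }
  map_one' := by ext1 f; exact quasiRegularOp_one f
  map_mul' g k := by ext1 f; exact quasiRegularOp_mul g k f

/-! ### Square-integrable representations -/

section Representation

variable {G K : Type*} [Group G] [TopologicalSpace G] [MeasurableSpace G]
  [NormedAddCommGroup K] [InnerProductSpace ℂ K]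

/-- The voice transform `f ↦ (g ↦ ⟨f, π(g)ψ⟩)`. (In Mathlib the inner product is linear in the
second variable.) -/
def voice (π : G →* (K ≃ₗᵢ[ℂ] K)) (ψ f : K) (g : G) : ℂ := inner ℂ (π g ψ) f

/-- `ψ ≠ 0` is admissible if its voice transform takes values in `L²(G, μ)`. -/
def IsAdmissible (π : G →* (K ≃ₗᵢ[ℂ] K)) (μ : Measure G) (ψ : K) : Prop :=
  ψ ≠ 0 ∧ ∀ f : K, MemLp (voice π ψ f) 2 μ

/-- Topological irreducibility: the space is nonzero, and its only closed invariant subspaces are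
`0` and the whole space. -/
def IsTopIrreducible (π : G →* (K ≃ₗᵢ[ℂ] K)) : Prop :=
  Nontrivial K ∧ ∀ W : Submodule ℂ K, IsClosed (W : Set K) →
    (∀ g : G, ∀ v ∈ W, π g v ∈ W) → W = ⊥ ∨ W = ⊤

/-- A square-integrable representation: a strongly continuous, irreducible unitary representation
that has an admissible vector. -/
structure IsSquareIntegrable (π : G →* (K ≃ₗᵢ[ℂ] K)) (μ : Measure G) : Prop where
  continuous : ∀ v : K, Continuous fun g => π g v
  irreducible : IsTopIrreducible π
  exists_admissible : ∃ ψ : K, IsAdmissible π μ ψ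

end Representation

/-- `C_ψ = ∫ |𝓕ψ(ξ)|² / |ξ₁|ᵈ dξ ∈ [0, ∞]` with `d = n + 1`; here `𝓕` is the Fourier transform
of `L²(ℝᵈ)`, normalized by `e^{-2πi ξ·x}`. -/
def admissibilityConstant {n : ℕ} (ψ : L2 (n + 1)) : ℝ≥0∞ :=
  ∫⁻ ξ : EuclideanSpace ℝ (Fin (n + 1)), ‖(𝓕 ψ : L2 (n + 1)) ξ‖ₑ ^ 2 / ‖ξ 0‖ₑ ^ (n + 1)

end Shearlet

end

/-!
The voice transform is computed on the Fourier side: `⟨f, π(b, h)ψ⟩` is the inverse Fourier integral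
at `b` of `|det h|^{1/2} conj(ψ̂(hᵀ ξ)) f̂(ξ)` (`voice_eq_fourierInv`). Plancherel's theorem for
integrable functions, in a form valid also when both sides are infinite
(`lintegral_enorm_sq_fourierInv`), and Tonelli's theorem turn `∫ |⟨f, π(g)ψ⟩|² dg` into
`∫ |f̂(ξ)|² (∫ |ψ̂(hᵀ ξ)|² dh) dξ`. The dual action of `H` is free and transitive on the open set
`ξ₁ ≠ 0`, whose complement is null, so the inner integral is a constant, namely `C_ψ`
(`lintegral_dualOrbit`). This gives the orthogonality relation `∫ |⟨f, π(g)ψ⟩|² dg = C_ψ ‖f‖²` in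
`[0, ∞]` for all `ψ` and `f` (`lintegral_voice`), for a suitably normalized left Haar measure.

Everything follows from this relation. Admissibility of `ψ ≠ 0` means `C_ψ < ∞`, and `C_ψ > 0` means
`ψ ≠ 0`; the isometry statement is the relation itself; and if `f` is orthogonal to a closed
invariant subspace containing `w ≠ 0`, then `C_w ‖f‖² = 0` forces `f = 0`, which is irreducibility.

Both the left Haar measure and the orbit integral are made explicit in the coordinates `(b, s, a)`
of `(b, σ(s) δ(a))`, where the Haar measure is `|a|^{-(d + 1)} db ds da` (`isMulLeftInvariant_haar`).
Both need that left translations `s ↦ t * s = s + t B(s)` of the shearing group preserve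
Lebesgue measure (`measurePreserving_shearMul`). For right translations this is clear: they
are affine of determinant one. Left translations commute with them, so their Jacobian is
constant; and the constant is one, since the `k`-th power of a unipotent matrix grows polynomially
in `k`, whereas a Jacobian different from one would make the volume of `tᵏ * U`, or of its counterpart
for `t⁻¹`, grow exponentially.
-/

noncomputable section

namespace Shearlet

/-! ### Plancherel's theorem for integrable functions -/

section Plancherel

variable {E : Type*} [NormedAddCommGroup E] [InnerProductSpace ℝ E] [FiniteDimensional ℝ E]
  [MeasurableSpace E] [BorelSpace E]

open SchwartzMap

lemma ae_eq_of_integral_schwartz_smul_eq {u v : E → ℂ} (hu : LocallyIntegrable u)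
    (hv : LocallyIntegrable v)
    (h : ∀ g : 𝓢(E, ℂ), ∫ x, g x • u x = ∫ x, g x • v x) : u =ᵐ[volume] v := by
  refine ae_eq_of_integral_contDiff_smul_eq hu hv fun g g_smooth g_cpt => ?_
  have hg₁ : HasCompactSupport (Complex.ofRealCLM ∘ g) := g_cpt.comp_left rfl
  have hg₂ : ContDiff ℝ ∞ (Complex.ofRealCLM ∘ g) := by fun_prop
  simpa using h (hg₁.toSchwartzMap hg₂)

lemma integral_schwartz_smul_fourier {F : E → ℂ} (hF : Integrable F) (g : 𝓢(E, ℂ)) :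
    ∫ ξ, g ξ • 𝓕 F ξ = ∫ x, 𝓕 g x • F x := by
  have := VectorFourier.integral_fourierIntegral_smul_eq_flip (L := innerₗ E) (f := g) (g := F)
    (μ := volume) (ν := volume) Real.continuous_fourierChar continuous_inner g.integrable hF
  simpa using! this.symm

lemma integral_schwartz_smul_fourier_Lp (u : Lp (α := E) ℂ 2 volume) (g : 𝓢(E, ℂ)) :
    ∫ ξ, g ξ • (𝓕 u : Lp (α := E) ℂ 2 volume) ξ = ∫ x, 𝓕 g x • u x := by
  have := congrArg (fun T : 𝓢'(E, ℂ) => T g) (Lp.fourier_toTemperedDistribution_eq u)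
  simpa [TemperedDistribution.fourier_apply] using this.symm

lemma locallyIntegrable_fourier {F : E → ℂ} (hF : Integrable F) :
    LocallyIntegrable (𝓕 F) := by
  refine Continuous.locallyIntegrable ?_
  exact VectorFourier.fourierIntegral_continuous Real.continuous_fourierChar
    (by exact continuous_inner) hF

/-- On `L¹ ∩ L²` the Fourier transform of `L²` is given by the Fourier integral. -/
lemma coeFn_fourier_toLp {F : E → ℂ} (hF : Integrable F) (hF2 : MemLp F 2 volume) :
    (𝓕 (hF2.toLp F) : Lp (α := E) ℂ 2 volume) =ᵐ[volume] 𝓕 F := by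
  refine ae_eq_of_integral_schwartz_smul_eq
    ((Lp.memLp (μ := volume) _).locallyIntegrable (by norm_num))
    (locallyIntegrable_fourier hF) fun g => ?_
  rw [integral_schwartz_smul_fourier hF, integral_schwartz_smul_fourier_Lp]
  refine integral_congr_ae ?_
  filter_upwards [MemLp.coeFn_toLp (μ := volume) hF2] with x hx
  rw [hx]

/-- If the Fourier integral of an integrable function is square integrable, so is the function:
tested against Schwartz functions, it agrees with the inverse `L²` transform of its Fourier integral. -/
lemma memLp_two_of_memLp_fourier {F : E → ℂ} (hF : Integrable F)
    (h : MemLp (𝓕 F) 2 volume) : MemLp F 2 volume := by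
  have key : F =ᵐ[volume] (𝓕⁻ (h.toLp _) : Lp (α := E) ℂ 2 volume) := by
    refine ae_eq_of_integral_schwartz_smul_eq hF.locallyIntegrable
      ((Lp.memLp (μ := volume) _).locallyIntegrable (by norm_num)) fun g => ?_
    set w : Lp (α := E) ℂ 2 volume := 𝓕⁻ (h.toLp _) with hw
    have h1 : h.toLp _ = (𝓕 w : Lp (α := E) ℂ 2 volume) := by
      rw [hw, FourierTransform.fourier_fourierInv_eq]
    have h2 : g = 𝓕 (𝓕⁻ g : 𝓢(E, ℂ)) := (FourierTransform.fourier_fourierInv_eq g).symm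
    rw [h2, ← integral_schwartz_smul_fourier_Lp, ← integral_schwartz_smul_fourier hF, ← h1]
    refine integral_congr_ae ?_
    filter_upwards [h.coeFn_toLp] with x hx
    rw [hx]
  exact (memLp_congr_ae key).2 (Lp.memLp _)

/-- Plancherel's theorem for integrable functions, valid also when both sides are infinite. -/
lemma eLpNorm_fourier_eq {F : E → ℂ} (hF : Integrable F) :
    eLpNorm (𝓕 F) 2 volume = eLpNorm F 2 volume := by
  have hm : AEStronglyMeasurable (𝓕 F) volume := (locallyIntegrable_fourier hF).aestronglyMeasurable
  by_cases h : MemLp F 2 volume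
  · rw [← eLpNorm_congr_ae (coeFn_fourier_toLp hF h), ← eLpNorm_congr_ae h.coeFn_toLp]
    have := Lp.norm_fourier_eq (h.toLp F)
    rw [Lp.norm_def, Lp.norm_def, ENNReal.toReal_eq_toReal_iff' (Lp.eLpNorm_ne_top _)
      (Lp.eLpNorm_ne_top _)] at this
    exact this
  · have h' : ¬ MemLp (𝓕 F) 2 volume := fun h2 => h (memLp_two_of_memLp_fourier hF h2)
    have h1 : eLpNorm F 2 volume = ⊤ := by
      by_contra hne; exact h ⟨hF.1, lt_top_iff_ne_top.2 hne⟩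
    have h2 : eLpNorm (𝓕 F) 2 volume = ⊤ := by
      by_contra hne; exact h' ⟨hm, lt_top_iff_ne_top.2 hne⟩
    rw [h1, h2]

lemma lintegral_enorm_sq {α : Type*} [MeasurableSpace α] (ν : Measure α) (F : α → ℂ) :
    ∫⁻ x, ‖F x‖ₑ ^ 2 ∂ν = eLpNorm F 2 ν ^ 2 := by
  have := eLpNorm_nnreal_pow_eq_lintegral (f := F) (μ := ν) (p := 2) (by norm_num)
  simp only [NNReal.coe_ofNat, ENNReal.rpow_ofNat, ENNReal.coe_ofNat] at this
  exact this.symm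

lemma lintegral_enorm_sq_fourierInv {F : E → ℂ} (hF : Integrable F) :
    ∫⁻ x, ‖𝓕⁻ F x‖ₑ ^ 2 = ∫⁻ x, ‖F x‖ₑ ^ 2 := by
  have h1 : ∫⁻ x, ‖𝓕⁻ F x‖ₑ ^ 2 = ∫⁻ x, ‖𝓕 F x‖ₑ ^ 2 := by
    have := (Measure.measurePreserving_neg (volume : Measure E)).lintegral_comp_emb
      (MeasurableEquiv.neg E).measurableEmbedding (fun x => ‖𝓕 F x‖ₑ ^ 2)
    rw [← this]
    simp [Real.fourierInv_eq_fourier_neg]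
  rw [h1, lintegral_enorm_sq, lintegral_enorm_sq, eLpNorm_fourier_eq hF]

end Plancherel

/-! ### Shearing matrices and sequences of polynomial growth -/

section ShearMatrix

variable {n : ℕ}

open Matrix

lemma shearMatrix_mul (s t : Fin n → ℝ) (A C : Matrix (Fin n) (Fin n) ℝ) :
    shearMatrix s A * shearMatrix t C = shearMatrix (t + s ᵥ* C) (A * C) := by
  ext i j
  rw [Matrix.mul_apply, Fin.sum_univ_succ]
  refine Fin.cases ?_ (fun i => ?_) i <;> refine Fin.cases ?_ (fun j => ?_) j
  · simp [shearMatrix]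
  · simp [shearMatrix, Matrix.vecMul, dotProduct, add_comm]
  · simp [shearMatrix]
  · simp [shearMatrix, Matrix.mul_apply]

lemma shearMatrix_zero_one : shearMatrix (0 : Fin n → ℝ) 1 = 1 := by
  ext i j
  refine Fin.cases ?_ (fun i => ?_) i <;> refine Fin.cases ?_ (fun j => ?_) j
  · simp [shearMatrix]
  · simp [shearMatrix, (Fin.succ_ne_zero j).symm]
  · simp [shearMatrix]
  · simp [shearMatrix, Matrix.one_apply]

lemma shearMatrix_inj {s t : Fin n → ℝ} {A C : Matrix (Fin n) (Fin n) ℝ} :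
    shearMatrix s A = shearMatrix t C ↔ s = t ∧ A = C := by
  refine ⟨fun h => ⟨?_, ?_⟩, by rintro ⟨rfl, rfl⟩; rfl⟩
  · ext i
    simpa [shearMatrix] using congrFun (congrFun h 0) i.succ
  · ext i j
    simpa [shearMatrix] using congrFun (congrFun h i.succ) j.succ

lemma det_shearMatrix (s : Fin n → ℝ) (A : Matrix (Fin n) (Fin n) ℝ) :
    (shearMatrix s A).det = A.det := by
  rw [Matrix.det_succ_column_zero, Fin.sum_univ_succ]
  have : (shearMatrix s A).submatrix Fin.succ Fin.succ = A := by
    ext i j; simp [shearMatrix]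
  have h0 : shearMatrix s A 0 0 = 1 := rfl
  have h1 : ∀ i : Fin n, shearMatrix s A i.succ 0 = 0 := fun i => rfl
  simp [this, h0, h1]

lemma IsUnipotentUpper.det_eq_one {A : Matrix (Fin n) (Fin n) ℝ} (hA : IsUnipotentUpper A) :
    A.det = 1 := by
  rw [Matrix.det_of_isUpperTriangular hA.1]
  simp [hA.2]

end ShearMatrix

/-- The properties of the map `B` of a shearing subgroup: unipotent upper triangular values,
smoothness, and closure of the matrices `[[1, -sᵀ], [0, B(s)]]` under products and inverses, where
`t + s B(t)` is the parameter of the product of the matrices with parameters `s` and `t`. -/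
structure IsShearCocycle {n : ℕ} (B : (Fin n → ℝ) → Matrix (Fin n) (Fin n) ℝ) : Prop where
  unipotent : ∀ s, IsUnipotentUpper (B s)
  smooth : ∀ i j, ContDiff ℝ ∞ fun s => B s i j
  map_zero : B 0 = 1
  map_mul : ∀ s t, B (t + Matrix.vecMul s (B t)) = B s * B t
  exists_inv : ∀ s, ∃ t, t + Matrix.vecMul s (B t) = 0 ∧ s + Matrix.vecMul t (B s) = 0

/-- The product `s * t` of shearing parameters, `σ(s) σ(t) = σ(s * t)`. -/
def shearMul {n : ℕ} (B : (Fin n → ℝ) → Matrix (Fin n) (Fin n) ℝ) (s t : Fin n → ℝ) : Fin n → ℝ :=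
  t + Matrix.vecMul s (B t)

/-- A real sequence with at most polynomial growth. -/
def PolyBounded (a : ℕ → ℝ) : Prop := ∃ (C : ℝ) (m : ℕ), ∀ k : ℕ, |a k| ≤ C * (k + 1) ^ m

namespace PolyBounded

lemma const (c : ℝ) : PolyBounded fun _ => c := ⟨|c|, 0, fun k => by simp⟩

lemma nonneg_const {a : ℕ → ℝ} {C : ℝ} {m : ℕ} (h : ∀ k : ℕ, |a k| ≤ C * (k + 1) ^ m) : 0 ≤ C := by
  have := (abs_nonneg _).trans (h 0); simpa using this

lemma mono_abs {a b : ℕ → ℝ} (hb : PolyBounded b) (h : ∀ k, |a k| ≤ |b k|) : PolyBounded a := by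
  obtain ⟨C, m, hC⟩ := hb
  exact ⟨C, m, fun k => (h k).trans (hC k)⟩

lemma add {a b : ℕ → ℝ} (ha : PolyBounded a) (hb : PolyBounded b) :
    PolyBounded fun k => a k + b k := by
  obtain ⟨C, m, hC⟩ := ha
  obtain ⟨D, l, hD⟩ := hb
  refine ⟨C + D, m + l, fun k => (abs_add_le _ _).trans ?_⟩
  have h1 : (1 : ℝ) ≤ k + 1 := by simp
  rw [add_mul]
  refine add_le_add ((hC k).trans ?_) ((hD k).trans ?_)
  · exact mul_le_mul_of_nonneg_left (pow_le_pow_right₀ h1 (by omega)) (nonneg_const hC)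
  · exact mul_le_mul_of_nonneg_left (pow_le_pow_right₀ h1 (by omega)) (nonneg_const hD)

lemma mul {a b : ℕ → ℝ} (ha : PolyBounded a) (hb : PolyBounded b) :
    PolyBounded fun k => a k * b k := by
  obtain ⟨C, m, hC⟩ := ha
  obtain ⟨D, l, hD⟩ := hb
  refine ⟨C * D, m + l, fun k => ?_⟩
  rw [abs_mul, pow_add, mul_mul_mul_comm]
  exact mul_le_mul (hC k) (hD k) (abs_nonneg _) ((abs_nonneg _).trans (hC k))

lemma pow {a : ℕ → ℝ} (ha : PolyBounded a) (j : ℕ) : PolyBounded fun k => a k ^ j := by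
  induction j with
  | zero => simpa using const 1
  | succ j ih => simpa [pow_succ] using ih.mul ha

lemma sum {ι : Type*} (s : Finset ι) {a : ι → ℕ → ℝ} (h : ∀ i ∈ s, PolyBounded (a i)) :
    PolyBounded fun k => ∑ i ∈ s, a i k := by
  classical
  induction s using Finset.induction_on with
  | empty => simpa using const 0
  | insert i s hi ih =>
    simp only [Finset.sum_insert hi]
    exact (h i (by simp)).add (ih fun j hj => h j (by simp [hj]))

lemma of_sub_succ {a : ℕ → ℝ} (h : PolyBounded fun k => a (k + 1) - a k) : PolyBounded a := by
  obtain ⟨C, m, hC⟩ := h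
  have hC0 := nonneg_const hC
  refine ⟨|a 0| + C, m + 1, fun k => ?_⟩
  have key : ∀ k : ℕ, |a k| ≤ |a 0| + k * (C * (k + 1) ^ m) := by
    intro k
    induction k with
    | zero => simp
    | succ k ih =>
      have h1 : |a (k + 1)| ≤ |a k| + |a (k + 1) - a k| := by
        have := abs_add_le (a k) (a (k + 1) - a k); simpa using this
      have h2 : C * ((k : ℝ) + 1) ^ m ≤ C * (((k + 1 : ℕ) : ℝ) + 1) ^ m := by
        push_cast
        gcongr ?_ * ?_ ^ _
        linarith
      have h3 := hC k
      have h4 : (k : ℝ) * (C * ((k : ℝ) + 1) ^ m) ≤ k * (C * (((k + 1 : ℕ) : ℝ) + 1) ^ m) := by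
        gcongr
      push_cast at *
      linarith
  refine (key k).trans ?_
  have h1 : (1 : ℝ) ≤ (k + 1) ^ (m + 1) := one_le_pow₀ (by simp)
  have h2 : (k : ℝ) * (C * (k + 1) ^ m) ≤ C * (k + 1) ^ (m + 1) := by
    rw [pow_succ]
    have : 0 ≤ C * ((k : ℝ) + 1) ^ m := by positivity
    nlinarith
  have h3 := mul_le_mul_of_nonneg_left h1 (abs_nonneg (a 0))
  linarith

/-- A geometric sequence of polynomial growth has ratio at most one. -/
lemma le_one_of_pow {c : ℝ} (h : PolyBounded fun k => c ^ k) : c ≤ 1 := by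
  by_contra! hc
  obtain ⟨C, m, hC⟩ := h
  have h1 := (tendsto_pow_const_div_const_pow_of_one_lt m hc).comp (Filter.tendsto_add_atTop_nat 1)
  have h2 : Filter.Tendsto (fun k : ℕ => C * c * (((k + 1 : ℕ) : ℝ) ^ m / c ^ (k + 1)))
      Filter.atTop (nhds (C * c * 0)) := h1.const_mul _
  rw [mul_zero] at h2
  obtain ⟨k, hk⟩ := (h2.eventually (gt_mem_nhds one_pos)).exists
  have hk' := hC k
  have hp : 0 < c ^ k := by positivity
  rw [abs_of_pos hp] at hk'
  push_cast at hk
  rw [pow_succ, mul_div_assoc', div_lt_one (by positivity)] at hk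
  nlinarith

end PolyBounded

/-- The orbit of `0` under `v ↦ t + v M`, for `M` unipotent upper triangular, grows at most
polynomially: the `i`-th coordinate increases by a combination of earlier ones. -/
lemma polyBounded_iterate {n : ℕ} {M : Matrix (Fin n) (Fin n) ℝ} (hM : IsUnipotentUpper M)
    (t : Fin n → ℝ) (v : ℕ → Fin n → ℝ) (hv : ∀ k, v (k + 1) = t + Matrix.vecMul (v k) M)
    (i : Fin n) : PolyBounded fun k => v k i := by
  induction i using WellFoundedLT.induction with
  | ind i ih =>
    refine PolyBounded.of_sub_succ ?_
    have h : ∀ k, v (k + 1) i - v k i =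
        t i + ∑ j ∈ Finset.univ.filter (· < i), v k j * M j i := by
      intro k
      rw [hv k, Pi.add_apply, Matrix.vecMul, dotProduct,
        ← Finset.sum_filter_add_sum_filter_not Finset.univ (· < i)]
      have h1 : ∑ j ∈ Finset.univ.filter (fun j => ¬ j < i), v k j * M j i = v k i := by
        rw [Finset.sum_eq_single i]
        · rw [hM.2, mul_one]
        · intro j hj hji
          have : i < j := lt_of_le_of_ne (by simpa using hj) hji.symm
          rw [hM.1 this, mul_zero]
        · simp
      rw [h1]; ring
    simp_rw [h]
    refine (PolyBounded.const _).add (PolyBounded.sum _ fun j hj => ?_)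
    exact (ih j (by simpa using hj)).mul (PolyBounded.const _)

/-! ### Unimodularity of the shearing group -/

namespace IsShearCocycle

variable {n : ℕ} {B : (Fin n → ℝ) → Matrix (Fin n) (Fin n) ℝ}

lemma shearMul_assoc (hB : IsShearCocycle B) (s t u : Fin n → ℝ) :
    shearMul B (shearMul B s t) u = shearMul B s (shearMul B t u) := by
  have h := hB.map_mul t u
  simp only [shearMul] at h ⊢
  rw [h, Matrix.add_vecMul, Matrix.vecMul_vecMul, add_assoc]

lemma zero_shearMul (s : Fin n → ℝ) : shearMul B 0 s = s := by
  simp [shearMul]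

lemma exists_shearMul_inv (hB : IsShearCocycle B) (s : Fin n → ℝ) :
    ∃ t, shearMul B s t = 0 ∧ shearMul B t s = 0 := hB.exists_inv s

lemma contDiff_shearMul (hB : IsShearCocycle B) (s : Fin n → ℝ) :
    ContDiff ℝ ∞ (shearMul B s) := by
  refine contDiff_id.add (contDiff_pi.2 fun j => ?_)
  simp only [Matrix.vecMul, dotProduct]
  exact ContDiff.sum fun i _ => contDiff_const.mul (hB.smooth i j)

lemma continuous_entry (hB : IsShearCocycle B) (i j : Fin n) : Continuous fun s => B s i j :=
  (hB.smooth i j).continuous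

lemma injective_shearMul (hB : IsShearCocycle B) (s : Fin n → ℝ) :
    Function.Injective (shearMul B s) := by
  obtain ⟨t, -, ht⟩ := hB.exists_shearMul_inv s
  intro u v huv
  have := congrArg (shearMul B t) huv
  simpa only [← hB.shearMul_assoc, ht, zero_shearMul] using this

/-- The Jacobian determinant of a left translation is constant, because left translations commute
with right translations, and these are affine maps of determinant one. -/
lemma det_fderiv_shearMul (hB : IsShearCocycle B) (t u : Fin n → ℝ) :
    (fderiv ℝ (shearMul B t) u).det = (fderiv ℝ (shearMul B t) 0).det := by
  have hd : ∀ x, HasFDerivAt (shearMul B t) (fderiv ℝ (shearMul B t) x) x := fun x =>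
    ((hB.contDiff_shearMul t).differentiable (by simp) x).hasFDerivAt
  let R : (Fin n → ℝ) →L[ℝ] (Fin n → ℝ) := LinearMap.toContinuousLinearMap (B u).vecMulLinear
  have hR : ∀ x, HasFDerivAt (fun s => shearMul B s u) R x := fun x => by
    have := R.hasFDerivAt (x := x)
    exact this.const_add u
  have hdet : R.det = 1 := by
    have h1 : R.det = LinearMap.det (B u).vecMulLinear := rfl
    have h2 : (B u).vecMulLinear = Matrix.toLin' (B u).transpose := by
      ext x i; simp
    rw [h1, h2, LinearMap.det_toLin', Matrix.det_transpose, (hB.unipotent u).det_eq_one]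
  have h0 : shearMul B 0 u = u := zero_shearMul u
  have h1 : HasFDerivAt (fun s => shearMul B t (shearMul B s u))
      ((fderiv ℝ (shearMul B t) u).comp R) 0 := by
    have h2 := hd (shearMul B 0 u)
    rw [h0] at h2
    exact HasFDerivAt.comp (g := shearMul B t) (0 : Fin n → ℝ) (by rw [h0]; exact h2) (hR 0)
  have h2 : HasFDerivAt (fun s => shearMul B (shearMul B t s) u)
      (R.comp (fderiv ℝ (shearMul B t) 0)) 0 :=
    HasFDerivAt.comp (g := fun s => shearMul B s u) (0 : Fin n → ℝ) (hR _) (hd 0)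
  simp only [hB.shearMul_assoc] at h2
  have h3 := congrArg ContinuousLinearMap.det (h1.unique h2)
  have hmul : ∀ A C : (Fin n → ℝ) →L[ℝ] (Fin n → ℝ), (A.comp C).det = A.det * C.det :=
    fun A C => LinearMap.det_comp (A : (Fin n → ℝ) →ₗ[ℝ] (Fin n → ℝ)) C
  rw [hmul, hmul, hdet] at h3
  simpa using h3

/-- The factor by which left translation by `t` scales Lebesgue measure. -/
def leftModulus (B : (Fin n → ℝ) → Matrix (Fin n) (Fin n) ℝ) (t : Fin n → ℝ) : ℝ :=
  |(fderiv ℝ (shearMul B t) 0).det|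

lemma leftModulus_nonneg (B : (Fin n → ℝ) → Matrix (Fin n) (Fin n) ℝ) (t : Fin n → ℝ) :
    0 ≤ leftModulus B t := abs_nonneg _

lemma volume_image_shearMul (hB : IsShearCocycle B) (t : Fin n → ℝ) {A : Set (Fin n → ℝ)}
    (hA : MeasurableSet A) :
    volume (shearMul B t '' A) = ENNReal.ofReal (leftModulus B t) * volume A := by
  rw [← lintegral_abs_det_fderiv_eq_addHaar_image volume hA
    (fun x _ => ((hB.contDiff_shearMul t).differentiable (by simp) x).hasFDerivAt.hasFDerivWithinAt)
    (hB.injective_shearMul t).injOn]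
  simp only [hB.det_fderiv_shearMul t, leftModulus]
  rw [lintegral_const, Measure.restrict_apply_univ]

lemma image_shearMul_shearMul (hB : IsShearCocycle B) (s t : Fin n → ℝ) (A : Set (Fin n → ℝ)) :
    shearMul B s '' (shearMul B t '' A) = shearMul B (shearMul B s t) '' A := by
  simp only [Set.image_image, hB.shearMul_assoc]

lemma measurableSet_image_shearMul (hB : IsShearCocycle B) (t : Fin n → ℝ) {A : Set (Fin n → ℝ)}
    (hA : MeasurableSet A) : MeasurableSet (shearMul B t '' A) :=
  hA.image_of_continuousOn_injOn (hB.contDiff_shearMul t).continuous.continuousOn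
    (hB.injective_shearMul t).injOn

lemma leftModulus_mul (hB : IsShearCocycle B) (s t : Fin n → ℝ) :
    leftModulus B (shearMul B s t) = leftModulus B s * leftModulus B t := by
  have hs : MeasurableSet (Metric.closedBall (0 : Fin n → ℝ) 1) := measurableSet_closedBall
  have h := hB.volume_image_shearMul (shearMul B s t) hs
  rw [← hB.image_shearMul_shearMul, hB.volume_image_shearMul s
    (hB.measurableSet_image_shearMul t hs), hB.volume_image_shearMul t hs, ← mul_assoc,
    ← ENNReal.ofReal_mul (leftModulus_nonneg B s)] at h
  have h1 : volume (Metric.closedBall (0 : Fin n → ℝ) 1) ≠ 0 :=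
    (Metric.measure_closedBall_pos _ _ one_pos).ne'
  have h2 : volume (Metric.closedBall (0 : Fin n → ℝ) 1) ≠ ⊤ := measure_closedBall_lt_top.ne
  rw [ENNReal.mul_left_inj h1 h2, ENNReal.ofReal_eq_ofReal_iff
    (mul_nonneg (leftModulus_nonneg B s) (leftModulus_nonneg B t)) (leftModulus_nonneg B _)] at h
  exact h.symm

lemma leftModulus_zero (B : (Fin n → ℝ) → Matrix (Fin n) (Fin n) ℝ) : leftModulus B 0 = 1 := by
  have : shearMul B 0 = id := funext fun s => zero_shearMul s
  simp [leftModulus, this, ContinuousLinearMap.det]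

/-- The powers of a shearing parameter grow polynomially, so left translation by them enlarges the
volume of a ball only polynomially. -/
lemma leftModulus_le_one (hB : IsShearCocycle B) (t : Fin n → ℝ) : leftModulus B t ≤ 1 := by
  let v : ℕ → Fin n → ℝ := fun k => (fun u => shearMul B u t)^[k] 0
  have hv : ∀ k, v (k + 1) = shearMul B (v k) t := fun k => Function.iterate_succ_apply' _ _ _
  have hpow : ∀ k, leftModulus B (v k) = leftModulus B t ^ k := by
    intro k
    induction k with
    | zero => simpa [v] using leftModulus_zero B
    | succ k ih => rw [hv, hB.leftModulus_mul, ih, pow_succ]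
  have hvb := polyBounded_iterate (hB.unipotent t) t v hv
  -- a common bound for the entries of `B` on the unit ball
  obtain ⟨K, hK⟩ : ∃ K : ℝ, ∀ s ∈ Metric.closedBall (0 : Fin n → ℝ) 1, ∀ i j, |B s i j| ≤ K := by
    have : ∀ i j, ∃ K : ℝ, ∀ s ∈ Metric.closedBall (0 : Fin n → ℝ) 1, |B s i j| ≤ K := fun i j => by
      obtain ⟨K, hK⟩ := (isCompact_closedBall (0 : Fin n → ℝ) 1).exists_bound_of_continuousOn
        (hB.continuous_entry i j).continuousOn
      exact ⟨K, hK⟩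
    choose K hK using this
    refine ⟨∑ i, ∑ j, |K i j|, fun s hs i j => (hK i j s hs).trans ((le_abs_self _).trans ?_)⟩
    refine le_trans ?_ (Finset.single_le_sum (f := fun i => ∑ j, |K i j|)
      (fun i _ => Finset.sum_nonneg fun j _ => abs_nonneg _) (Finset.mem_univ i))
    exact Finset.single_le_sum (f := fun j => |K i j|) (fun j _ => abs_nonneg _)
      (Finset.mem_univ j)
  let r : ℕ → ℝ := fun k => 1 + ∑ i, |v k i| * |K|
  have hr0 : ∀ k, 0 ≤ r k := fun k => by positivity
  have himg : ∀ k, shearMul B (v k) '' Metric.closedBall 0 1 ⊆ Metric.closedBall 0 (r k) := by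
    rintro k _ ⟨s, hs, rfl⟩
    rw [mem_closedBall_zero_iff, pi_norm_le_iff_of_nonneg (hr0 k)]
    intro j
    have h1 : ‖s j‖ ≤ 1 := (norm_le_pi_norm s j).trans (by simpa using hs)
    refine (norm_add_le (s j) (Matrix.vecMul (v k) (B s) j)).trans (add_le_add h1 ?_)
    refine (norm_sum_le Finset.univ fun i => v k i * B s i j).trans
      (Finset.sum_le_sum fun i _ => ?_)
    rw [norm_mul]
    exact mul_le_mul_of_nonneg_left ((hK s hs i j).trans (le_abs_self _)) (norm_nonneg _)
  have hvol : ∀ k, leftModulus B t ^ k * 2 ^ n ≤ (2 * r k) ^ n := by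
    intro k
    have h := measure_mono (μ := volume) (himg k)
    rw [hB.volume_image_shearMul _ measurableSet_closedBall, hpow,
      Real.volume_pi_closedBall _ zero_le_one, Real.volume_pi_closedBall _ (hr0 k),
      ← ENNReal.ofReal_mul (pow_nonneg (leftModulus_nonneg B t) k),
      ENNReal.ofReal_le_ofReal_iff (by have := hr0 k; positivity)] at h
    simpa using h
  refine PolyBounded.le_one_of_pow ?_
  have hr : PolyBounded r := (PolyBounded.const 1).add (PolyBounded.sum _ fun i _ =>
    ((hvb i).mono_abs fun k => by simp).mul (PolyBounded.const _))
  refine (((PolyBounded.const 2).mul hr).pow n).mono_abs fun k => ?_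
  have h1 : (1 : ℝ) ≤ 2 ^ n := one_le_pow₀ (by norm_num)
  have h2 : 0 ≤ leftModulus B t ^ k := pow_nonneg (leftModulus_nonneg B t) k
  rw [abs_of_nonneg h2]
  refine le_trans ?_ (le_abs_self _)
  refine le_trans ?_ (hvol k)
  nlinarith

lemma leftModulus_eq_one (hB : IsShearCocycle B) (t : Fin n → ℝ) : leftModulus B t = 1 := by
  obtain ⟨u, hu, -⟩ := hB.exists_shearMul_inv t
  have h := hB.leftModulus_mul t u
  rw [hu, leftModulus_zero] at h
  have h1 := hB.leftModulus_le_one t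
  have h2 := hB.leftModulus_le_one u
  have h3 : 0 ≤ leftModulus B t := leftModulus_nonneg B t
  nlinarith

/-- The shearing group is unimodular: left translations preserve Lebesgue measure. -/
lemma measurePreserving_shearMul (hB : IsShearCocycle B) (t : Fin n → ℝ) :
    MeasurePreserving (shearMul B t) volume volume := by
  refine ⟨(hB.contDiff_shearMul t).continuous.measurable, ?_⟩
  ext A hA
  rw [Measure.map_apply (hB.contDiff_shearMul t).continuous.measurable hA]
  obtain ⟨u, hu, hu'⟩ := hB.exists_shearMul_inv t
  have : shearMul B t ⁻¹' A = shearMul B u '' A := by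
    ext s
    constructor
    · intro hs
      exact ⟨_, hs, by rw [← hB.shearMul_assoc, hu', zero_shearMul]⟩
    · rintro ⟨s, hs, rfl⟩
      rwa [Set.mem_preimage, ← hB.shearMul_assoc, hu, zero_shearMul]
  rw [this, hB.volume_image_shearMul u hA, hB.leftModulus_eq_one]
  simp

end IsShearCocycle

/-! ### Coordinates on a shearlet dilation group -/

section Parametrization

variable {n : ℕ}

/-- The matrix `σ(s) δ(a)` of the element of a shearlet dilation group with shearing parameter `s`
and scaling parameter `a`. -/
def dilationMatrix (B : (Fin n → ℝ) → Matrix (Fin n) (Fin n) ℝ) (l s : Fin n → ℝ) (a : ℝ) :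
    Matrix (Fin (n + 1)) (Fin (n + 1)) ℝ :=
  shearMatrix s (B s) * scalingMatrix l a

/-- `H` is the shearlet dilation group given by `B` and `l`; the matrix with scaling parameter `a`
acts by conjugation on the shearing parameters as `s ↦ |a|^{-l} s`. -/
structure IsShearletPresentation (B : (Fin n → ℝ) → Matrix (Fin n) (Fin n) ℝ) (l : Fin n → ℝ)
    (H : Subgroup (GL (Fin (n + 1)) ℝ)) : Prop where
  cocycle : IsShearCocycle B
  mem_iff : ∀ h : GL (Fin (n + 1)) ℝ, h ∈ H ↔ ∃ s a, a ≠ 0 ∧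
    (h : Matrix (Fin (n + 1)) (Fin (n + 1)) ℝ) = dilationMatrix B l s a
  conj : ∀ s a, a ≠ 0 → scalingMatrix l a * shearMatrix s (B s) =
    dilationMatrix B l (fun i => |a| ^ (-l i) * s i) a

lemma scalingMatrix_eq_diagonal (l : Fin n → ℝ) (a : ℝ) :
    scalingMatrix l a = Matrix.diagonal (Fin.cons a fun i => a * |a| ^ l i) := by
  rw [scalingMatrix, ← Matrix.diagonal_smul]
  congr 1
  ext i
  refine Fin.cases ?_ (fun i => ?_) i <;> simp

lemma mul_scalingMatrix_apply (l : Fin n → ℝ) (a : ℝ) (M : Matrix (Fin (n + 1)) (Fin (n + 1)) ℝ)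
    (i j : Fin (n + 1)) :
    (M * scalingMatrix l a) i j =
      M i j * (Fin.cons a fun k => a * |a| ^ l k : Fin (n + 1) → ℝ) j := by
  rw [scalingMatrix_eq_diagonal, Matrix.mul_diagonal]

lemma scalingMatrix_mul_apply (l : Fin n → ℝ) (a : ℝ) (M : Matrix (Fin (n + 1)) (Fin (n + 1)) ℝ)
    (i j : Fin (n + 1)) :
    (scalingMatrix l a * M) i j =
      (Fin.cons a fun k => a * |a| ^ l k : Fin (n + 1) → ℝ) i * M i j := by
  rw [scalingMatrix_eq_diagonal, Matrix.diagonal_mul]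

lemma scalingMatrix_mul (l : Fin n → ℝ) (a b : ℝ) :
    scalingMatrix l a * scalingMatrix l b = scalingMatrix l (a * b) := by
  simp only [scalingMatrix_eq_diagonal, Matrix.diagonal_mul_diagonal]
  congr 1
  ext i
  refine Fin.cases ?_ (fun i => ?_) i
  · simp
  · simp only [Fin.cons_succ, abs_mul, Real.mul_rpow (abs_nonneg a) (abs_nonneg b)]
    ring

lemma scalingMatrix_one (l : Fin n → ℝ) : scalingMatrix l 1 = 1 := by
  rw [scalingMatrix_eq_diagonal, ← Matrix.diagonal_one]
  congr 1
  ext i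
  refine Fin.cases ?_ (fun i => ?_) i <;> simp

lemma det_scalingMatrix (l : Fin n → ℝ) (a : ℝ) :
    (scalingMatrix l a).det = a * ∏ i, a * |a| ^ l i := by
  rw [scalingMatrix_eq_diagonal, Matrix.det_diagonal, Fin.prod_univ_succ]
  simp

lemma det_scalingMatrix_ne_zero (l : Fin n → ℝ) {a : ℝ} (ha : a ≠ 0) :
    (scalingMatrix l a).det ≠ 0 := by
  rw [det_scalingMatrix]
  exact mul_ne_zero ha (Finset.prod_ne_zero_iff.2 fun i _ =>
    mul_ne_zero ha (Real.rpow_pos_of_pos (abs_pos.2 ha) _).ne')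

variable {B : (Fin n → ℝ) → Matrix (Fin n) (Fin n) ℝ} {l : Fin n → ℝ}

lemma dilationMatrix_zero_zero (s : Fin n → ℝ) (a : ℝ) : dilationMatrix B l s a 0 0 = a := by
  rw [dilationMatrix, mul_scalingMatrix_apply]; simp [shearMatrix]

lemma dilationMatrix_zero_succ (s : Fin n → ℝ) (a : ℝ) (j : Fin n) :
    dilationMatrix B l s a 0 j.succ = -s j * (a * |a| ^ l j) := by
  rw [dilationMatrix, mul_scalingMatrix_apply]; simp [shearMatrix]

lemma dilationMatrix_succ_zero (s : Fin n → ℝ) (a : ℝ) (i : Fin n) :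
    dilationMatrix B l s a i.succ 0 = 0 := by
  rw [dilationMatrix, mul_scalingMatrix_apply]; simp [shearMatrix]

lemma dilationMatrix_succ_succ (s : Fin n → ℝ) (a : ℝ) (i j : Fin n) :
    dilationMatrix B l s a i.succ j.succ = B s i j * (a * |a| ^ l j) := by
  rw [dilationMatrix, mul_scalingMatrix_apply]; simp [shearMatrix]

lemma dilationMatrix_one (s : Fin n → ℝ) : dilationMatrix B l s 1 = shearMatrix s (B s) := by
  rw [dilationMatrix, scalingMatrix_one, mul_one]

lemma IsShearCocycle.det_dilationMatrix (hB : IsShearCocycle B) (s : Fin n → ℝ) (a : ℝ) :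
    (dilationMatrix B l s a).det = a * ∏ i, a * |a| ^ l i := by
  rw [dilationMatrix, Matrix.det_mul, det_shearMatrix, (hB.unipotent s).det_eq_one, one_mul,
    det_scalingMatrix]

lemma IsShearCocycle.det_dilationMatrix_ne_zero (hB : IsShearCocycle B) (s : Fin n → ℝ) {a : ℝ}
    (ha : a ≠ 0) : (dilationMatrix B l s a).det ≠ 0 := by
  rw [hB.det_dilationMatrix, ← det_scalingMatrix]
  exact det_scalingMatrix_ne_zero l ha

lemma isShearCocycle_of_mem_iff {S : Subgroup (GL (Fin (n + 1)) ℝ)}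
    (hU : ∀ s, IsUnipotentUpper (B s)) (hC : ∀ i j, ContDiff ℝ ∞ fun s => B s i j)
    (hS : ∀ g : GL (Fin (n + 1)) ℝ,
      g ∈ S ↔ ∃ s, (g : Matrix (Fin (n + 1)) (Fin (n + 1)) ℝ) = shearMatrix s (B s)) :
    IsShearCocycle B := by
  have hex : ∀ s, ∃ g ∈ S, (g : Matrix (Fin (n + 1)) (Fin (n + 1)) ℝ) = shearMatrix s (B s) := by
    intro s
    refine ⟨Matrix.GeneralLinearGroup.mkOfDetNeZero (shearMatrix s (B s)) ?_,
      (hS _).2 ⟨s, rfl⟩, rfl⟩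
    rw [det_shearMatrix, (hU s).det_eq_one]
    exact one_ne_zero
  have hone : B 0 = 1 := by
    obtain ⟨s, hs⟩ := (hS 1).1 S.one_mem
    rw [Units.val_one, ← shearMatrix_zero_one, shearMatrix_inj] at hs
    rw [hs.1, hs.2]
  have hmul : ∀ s t, B (t + Matrix.vecMul s (B t)) = B s * B t := by
    intro s t
    obtain ⟨g, hg, hgs⟩ := hex s
    obtain ⟨k, hk, hkt⟩ := hex t
    obtain ⟨u, hu⟩ := (hS _).1 (S.mul_mem hg hk)
    rw [Units.val_mul, hgs, hkt, shearMatrix_mul, shearMatrix_inj] at hu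
    rw [hu.1, hu.2]
  refine ⟨hU, hC, hone, hmul, fun s => ?_⟩
  obtain ⟨g, hg, hgs⟩ := hex s
  obtain ⟨t, ht⟩ := (hS _).1 (S.inv_mem hg)
  have h1 : (g : Matrix (Fin (n + 1)) (Fin (n + 1)) ℝ) * (g⁻¹ : GL (Fin (n + 1)) ℝ) = 1 :=
    Units.mul_inv g
  have h2 : ((g⁻¹ : GL (Fin (n + 1)) ℝ) : Matrix (Fin (n + 1)) (Fin (n + 1)) ℝ) * g = 1 :=
    Units.inv_mul g
  rw [hgs, ht, shearMatrix_mul, ← shearMatrix_zero_one, shearMatrix_inj] at h1 h2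
  exact ⟨t, h1.1, h2.1⟩

lemma IsShearletDilationGroup.exists_presentation {H : Subgroup (GL (Fin (n + 1)) ℝ)}
    (hH : IsShearletDilationGroup H) : ∃ B l, IsShearletPresentation B l H := by
  obtain ⟨S, D, ⟨B, hU, hC, hS⟩, ⟨l, hD⟩, hSD⟩ := hH
  have hB : IsShearCocycle B := isShearCocycle_of_mem_iff hU hC hS
  have hmem : ∀ h : GL (Fin (n + 1)) ℝ, h ∈ H ↔ ∃ s a, a ≠ 0 ∧
      (h : Matrix (Fin (n + 1)) (Fin (n + 1)) ℝ) = dilationMatrix B l s a := by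
    intro h
    rw [hSD]
    constructor
    · rintro ⟨σ, hσ, δ, hδ, rfl⟩
      obtain ⟨s, hs⟩ := (hS σ).1 hσ
      obtain ⟨a, ha, hδ⟩ := (hD δ).1 hδ
      exact ⟨s, a, ha, by rw [Units.val_mul, hs, hδ, dilationMatrix]⟩
    · rintro ⟨s, a, ha, h1⟩
      refine ⟨Matrix.GeneralLinearGroup.mkOfDetNeZero (shearMatrix s (B s)) ?_, (hS _).2 ⟨s, rfl⟩,
        Matrix.GeneralLinearGroup.mkOfDetNeZero (scalingMatrix l a)
          (det_scalingMatrix_ne_zero l ha), (hD _).2 ⟨a, ha, rfl⟩, Units.ext h1⟩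
      rw [det_shearMatrix, (hU s).det_eq_one]
      exact one_ne_zero
  refine ⟨B, l, hB, hmem, fun s a ha => ?_⟩
  let δ := Matrix.GeneralLinearGroup.mkOfDetNeZero (scalingMatrix l a)
    (det_scalingMatrix_ne_zero l ha)
  let σ := Matrix.GeneralLinearGroup.mkOfDetNeZero (dilationMatrix B l s 1)
    (hB.det_dilationMatrix_ne_zero s one_ne_zero)
  have hδ : δ ∈ H := (hmem δ).2 ⟨0, a, ha, by
    rw [dilationMatrix, hB.map_zero, shearMatrix_zero_one, one_mul]; rfl⟩
  have hσ : σ ∈ H := (hmem σ).2 ⟨s, 1, one_ne_zero, rfl⟩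
  obtain ⟨t, b, hb, h⟩ := (hmem _).1 (H.mul_mem hδ hσ)
  have h : scalingMatrix l a * dilationMatrix B l s 1 = dilationMatrix B l t b := h
  rw [dilationMatrix_one] at h
  -- both parameters on the right are read off from the first row
  have hab : a = b := by
    have := congrFun (congrFun h 0) 0
    rw [scalingMatrix_mul_apply, dilationMatrix_zero_zero] at this
    simpa [shearMatrix] using this
  subst hab
  rw [h]
  congr 1
  ext j
  have hj := congrFun (congrFun h 0) j.succ
  rw [scalingMatrix_mul_apply, dilationMatrix_zero_succ] at hj
  have hp : 0 < |a| ^ l j := Real.rpow_pos_of_pos (abs_pos.2 ha) _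
  simp only [Fin.cons_zero, shearMatrix, Matrix.of_apply, Fin.cons_succ, Pi.neg_apply] at hj
  rw [Real.rpow_neg (abs_nonneg a), inv_mul_eq_div, eq_div_iff hp.ne']
  have := mul_left_cancel₀ ha (show a * (t j * |a| ^ l j) = a * s j by linarith)
  exact this

lemma IsShearletPresentation.dilationMatrix_mul {H : Subgroup (GL (Fin (n + 1)) ℝ)}
    (hP : IsShearletPresentation B l H) (s t : Fin n → ℝ) {a : ℝ} (ha : a ≠ 0) (b : ℝ) :
    dilationMatrix B l s a * dilationMatrix B l t b =
      dilationMatrix B l (shearMul B s fun i => |a| ^ (-l i) * t i) (a * b) := by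
  set u : Fin n → ℝ := fun i => |a| ^ (-l i) * t i with hu
  calc dilationMatrix B l s a * dilationMatrix B l t b
      = shearMatrix s (B s) * (scalingMatrix l a * shearMatrix t (B t)) * scalingMatrix l b := by
        simp only [dilationMatrix, mul_assoc]
    _ = (shearMatrix s (B s) * shearMatrix u (B u)) * (scalingMatrix l a * scalingMatrix l b) := by
        rw [hP.conj t a ha, dilationMatrix]; simp only [mul_assoc, ← hu]
    _ = _ := by
        rw [shearMatrix_mul, scalingMatrix_mul, ← hP.cocycle.map_mul, dilationMatrix, shearMul]

end Parametrization

/-! ### The topological group `ℝᵈ ⋊ H` and its left Haar measure -/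

section Topology

variable {d : ℕ} (H : Subgroup (GL (Fin d) ℝ))

lemma continuous_act_uncurry :
    Continuous fun p : GL (Fin d) ℝ × EuclideanSpace ℝ (Fin d) => act p.1 p.2 := by
  have h : (fun p : GL (Fin d) ℝ × EuclideanSpace ℝ (Fin d) => act p.1 p.2) =
      fun p => WithLp.toLp 2 ((p.1 : Matrix (Fin d) (Fin d) ℝ).mulVec (WithLp.ofLp p.2)) := by
    funext p; simp [act, Matrix.toLpLin_apply]
  rw [h]
  refine (PiLp.continuous_toLp 2 _).comp ?_
  exact (Units.continuous_val.comp continuous_fst).matrix_mulVec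
    ((PiLp.continuous_ofLp 2 _).comp continuous_snd)

variable {H}

lemma AffineGroup.continuous_trans_right : Continuous
    fun g : AffineGroup H => ((AffineGroup.trans g, g.right) : EuclideanSpace ℝ (Fin d) × H) :=
  continuous_induced_dom

lemma AffineGroup.continuous_trans :
    Continuous (AffineGroup.trans : AffineGroup H → EuclideanSpace ℝ (Fin d)) :=
  continuous_fst.comp AffineGroup.continuous_trans_right

lemma AffineGroup.continuous_right : Continuous fun g : AffineGroup H => g.right :=
  continuous_snd.comp AffineGroup.continuous_trans_right

lemma AffineGroup.continuous_lin : Continuous (AffineGroup.lin : AffineGroup H → GL (Fin d) ℝ) :=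
  continuous_subtype_val.comp AffineGroup.continuous_right

lemma AffineGroup.continuous_iff {X : Type*} [TopologicalSpace X] {f : X → AffineGroup H} :
    Continuous f ↔ Continuous (fun x => AffineGroup.trans (f x)) ∧
      Continuous fun x => (f x).right := by
  rw [continuous_induced_rng]
  exact continuous_prodMk

lemma AffineGroup.trans_inv (g : AffineGroup H) :
    AffineGroup.trans g⁻¹ = -act (AffineGroup.lin g)⁻¹ (AffineGroup.trans g) := by
  have h := AffineGroup.trans_mul g⁻¹ g
  have h1 : AffineGroup.trans (1 : AffineGroup H) = 0 := rfl
  have h2 : AffineGroup.lin g⁻¹ = (AffineGroup.lin g)⁻¹ := rfl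
  rw [inv_mul_cancel, h1, h2] at h
  exact eq_neg_of_add_eq_zero_left h.symm

lemma AffineGroup.continuous_mul :
    Continuous fun p : AffineGroup H × AffineGroup H => p.1 * p.2 := by
  refine AffineGroup.continuous_iff.2 ⟨?_, ?_⟩
  · have h1 : Continuous fun p : AffineGroup H × AffineGroup H => AffineGroup.trans p.1 :=
      AffineGroup.continuous_trans.comp continuous_fst
    have h2 : Continuous fun p : AffineGroup H × AffineGroup H =>
        (AffineGroup.lin p.1, AffineGroup.trans p.2) :=
      (AffineGroup.continuous_lin.comp continuous_fst).prodMk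
        (AffineGroup.continuous_trans.comp continuous_snd)
    have h3 : Continuous fun p : AffineGroup H × AffineGroup H =>
        act (AffineGroup.lin p.1) (AffineGroup.trans p.2) := by
      simpa only [Function.comp_def] using (continuous_act_uncurry (d := d)).comp h2
    simp only [AffineGroup.trans_mul]
    exact h1.add h3
  · have h1 : Continuous fun p : AffineGroup H × AffineGroup H => p.1.right :=
      AffineGroup.continuous_right.comp continuous_fst
    have h2 : Continuous fun p : AffineGroup H × AffineGroup H => p.2.right :=
      AffineGroup.continuous_right.comp continuous_snd
    exact h1.mul h2

lemma AffineGroup.continuous_inv : Continuous fun g : AffineGroup H => g⁻¹ := by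
  refine AffineGroup.continuous_iff.2 ⟨?_, ?_⟩
  · simp only [AffineGroup.trans_inv]
    have h1 : Continuous fun g : AffineGroup H => (AffineGroup.lin g)⁻¹ :=
      AffineGroup.continuous_lin.inv
    exact (continuous_act_uncurry.comp (h1.prodMk AffineGroup.continuous_trans)).neg
  · exact Continuous.inv AffineGroup.continuous_right

instance instIsTopologicalGroupAffineGroup : IsTopologicalGroup (AffineGroup H) where
  continuous_mul := AffineGroup.continuous_mul
  continuous_inv := AffineGroup.continuous_inv

end Topology

section Coordinates

variable {n : ℕ} {B : (Fin n → ℝ) → Matrix (Fin n) (Fin n) ℝ} {l : Fin n → ℝ}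
  {H : Subgroup (GL (Fin (n + 1)) ℝ)}

/-- The coordinate space of `ℝᵈ ⋊ H`: translation, shearing and scaling parameter. -/
abbrev Coord (n : ℕ) : Type := EuclideanSpace ℝ (Fin (n + 1)) × (Fin n → ℝ) × ℝ

/-- The coordinates `(b, s, a)` of the group element `(b, σ(s) δ(a))`, read off from the first row
of the matrix. -/
def coord (l : Fin n → ℝ) (g : AffineGroup H) : Coord n :=
  let M : Matrix (Fin (n + 1)) (Fin (n + 1)) ℝ := AffineGroup.lin g
  (AffineGroup.trans g, fun j => -(M 0 j.succ / (M 0 0 * |M 0 0| ^ l j)), M 0 0)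

lemma coord_of_lin_eq {g : AffineGroup H} {s : Fin n → ℝ} {a : ℝ} (ha : a ≠ 0)
    (h : (AffineGroup.lin g : Matrix (Fin (n + 1)) (Fin (n + 1)) ℝ) = dilationMatrix B l s a) :
    coord l g = (AffineGroup.trans g, s, a) := by
  have hp : 0 < |a| := abs_pos.2 ha
  simp only [coord, h, dilationMatrix_zero_zero, dilationMatrix_zero_succ]
  congr 2
  ext j
  have := (Real.rpow_pos_of_pos hp (l j)).ne'
  field_simp

namespace IsShearletPresentation

lemma lin_eq (hP : IsShearletPresentation B l H) (g : AffineGroup H) :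
    (coord l g).2.2 ≠ 0 ∧ (AffineGroup.lin g : Matrix (Fin (n + 1)) (Fin (n + 1)) ℝ) =
      dilationMatrix B l (coord l g).2.1 (coord l g).2.2 := by
  obtain ⟨s, a, ha, h⟩ := (hP.mem_iff (AffineGroup.lin g)).1 g.right.2
  rw [coord_of_lin_eq ha h]
  exact ⟨ha, h⟩

/-- The group element with given coordinates. -/
def ofCoord (hP : IsShearletPresentation B l H) (p : {p : Coord n // p.2.2 ≠ 0}) : AffineGroup H :=
  ⟨Multiplicative.ofAdd p.1.1,
    ⟨Matrix.GeneralLinearGroup.mkOfDetNeZero (dilationMatrix B l p.1.2.1 p.1.2.2)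
      (hP.cocycle.det_dilationMatrix_ne_zero _ p.2), (hP.mem_iff _).2 ⟨_, _, p.2, rfl⟩⟩⟩

lemma coord_ofCoord (hP : IsShearletPresentation B l H) (p : {p : Coord n // p.2.2 ≠ 0}) :
    coord l (hP.ofCoord p) = p.1 :=
  coord_of_lin_eq (B := B) p.2 rfl

lemma coord_injective (hP : IsShearletPresentation B l H) :
    Function.Injective (coord l : AffineGroup H → Coord n) := by
  intro g k h
  have hg := (hP.lin_eq g).2
  have hk := (hP.lin_eq k).2
  have ht : AffineGroup.trans g = AffineGroup.trans k := congrArg Prod.fst h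
  rw [h, ← hk] at hg
  exact SemidirectProduct.ext ht (Subtype.ext (Units.ext hg))

lemma continuous_coord (hP : IsShearletPresentation B l H) :
    Continuous (coord l : AffineGroup H → Coord n) := by
  have he : ∀ i j, Continuous fun g : AffineGroup H =>
      (AffineGroup.lin g : Matrix (Fin (n + 1)) (Fin (n + 1)) ℝ) i j := fun i j =>
    (Units.continuous_val.comp AffineGroup.continuous_lin).matrix_elem i j
  have h0 : ∀ g : AffineGroup H,
      (AffineGroup.lin g : Matrix (Fin (n + 1)) (Fin (n + 1)) ℝ) 0 0 ≠ 0 := fun g =>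
    (hP.lin_eq g).1
  refine AffineGroup.continuous_trans.prodMk ((continuous_pi fun j => ?_).prodMk (he 0 0))
  refine ((he 0 j.succ).div₀ ((he 0 0).mul ((he 0 0).abs.rpow_const fun g => ?_)) fun g => ?_).neg
  · exact Or.inl (abs_ne_zero.2 (h0 g))
  · exact mul_ne_zero (h0 g) (Real.rpow_pos_of_pos (abs_pos.2 (h0 g)) _).ne'

lemma continuous_ofCoord (hP : IsShearletPresentation B l H) : Continuous hP.ofCoord := by
  have ha : Continuous fun p : {p : Coord n // p.2.2 ≠ 0} => p.1.2.2 :=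
    continuous_snd.comp (continuous_snd.comp continuous_subtype_val)
  have hs : Continuous fun p : {p : Coord n // p.2.2 ≠ 0} => p.1.2.1 :=
    continuous_fst.comp (continuous_snd.comp continuous_subtype_val)
  have hM : Continuous fun p : {p : Coord n // p.2.2 ≠ 0} =>
      dilationMatrix B l p.1.2.1 p.1.2.2 := by
    have hl : ∀ j, Continuous fun p : {p : Coord n // p.2.2 ≠ 0} => p.1.2.2 * |p.1.2.2| ^ l j :=
      fun j => ha.mul (ha.abs.rpow_const fun p => Or.inl (abs_ne_zero.2 p.2))
    refine continuous_matrix fun i j => ?_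
    refine Fin.cases ?_ (fun i => ?_) i <;> refine Fin.cases ?_ (fun j => ?_) j
    · simpa only [dilationMatrix_zero_zero] using ha
    · simp only [dilationMatrix_zero_succ]
      exact ((continuous_apply j).comp hs).neg.mul (hl j)
    · simp only [dilationMatrix_succ_zero]
      exact continuous_const
    · simp only [dilationMatrix_succ_succ]
      exact ((hP.cocycle.continuous_entry i j).comp hs).mul (hl j)
  rw [AffineGroup.continuous_iff]
  refine ⟨continuous_fst.comp continuous_subtype_val, ?_⟩
  refine Continuous.subtype_mk ?_ _
  rw [Units.continuous_iff]
  refine ⟨hM, ?_⟩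
  have : ∀ p : {p : Coord n // p.2.2 ≠ 0}, ((Matrix.GeneralLinearGroup.mkOfDetNeZero
      (dilationMatrix B l p.1.2.1 p.1.2.2) (hP.cocycle.det_dilationMatrix_ne_zero _ p.2))⁻¹ :
        GL (Fin (n + 1)) ℝ).val = (dilationMatrix B l p.1.2.1 p.1.2.2).det⁻¹ •
          (dilationMatrix B l p.1.2.1 p.1.2.2).adjugate := by
    intro p
    rw [Matrix.coe_units_inv, Matrix.inv_def, Ring.inverse_eq_inv]
    rfl
  refine Continuous.congr ?_ fun p => (this p).symm
  exact (hM.matrix_det.inv₀ fun p => hP.cocycle.det_dilationMatrix_ne_zero _ p.2).smul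
    hM.matrix_adjugate

/-- The coordinates are a homeomorphism of `ℝᵈ ⋊ H` onto the open set `a ≠ 0`. -/
def coordHomeomorph (hP : IsShearletPresentation B l H) :
    AffineGroup H ≃ₜ {p : Coord n // p.2.2 ≠ 0} where
  toFun g := ⟨coord l g, (hP.lin_eq g).1⟩
  invFun := hP.ofCoord
  left_inv _ := hP.coord_injective (hP.coord_ofCoord _)
  right_inv p := Subtype.ext (hP.coord_ofCoord p)
  continuous_toFun := hP.continuous_coord.subtype_mk _
  continuous_invFun := hP.continuous_ofCoord

lemma isOpenEmbedding_coord (hP : IsShearletPresentation B l H) :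
    Topology.IsOpenEmbedding (coord l : AffineGroup H → Coord n) := by
  have ho : IsOpen {p : Coord n | p.2.2 ≠ 0} :=
    isOpen_ne.preimage (continuous_snd.comp continuous_snd)
  exact ho.isOpenEmbedding_subtypeVal.comp hP.coordHomeomorph.isOpenEmbedding

lemma range_coord (hP : IsShearletPresentation B l H) :
    Set.range (coord l : AffineGroup H → Coord n) = {p | p.2.2 ≠ 0} := by
  ext p
  exact ⟨by rintro ⟨g, rfl⟩; exact (hP.lin_eq g).1,
    fun hp => ⟨hP.ofCoord ⟨p, hp⟩, hP.coord_ofCoord _⟩⟩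

lemma secondCountableTopology (hP : IsShearletPresentation B l H) :
    SecondCountableTopology (AffineGroup H) :=
  hP.isOpenEmbedding_coord.isEmbedding.secondCountableTopology

lemma locallyCompactSpace (hP : IsShearletPresentation B l H) :
    LocallyCompactSpace (AffineGroup H) :=
  hP.isOpenEmbedding_coord.locallyCompactSpace

lemma coord_mul (hP : IsShearletPresentation B l H) (g k : AffineGroup H) :
    coord l (g * k) = (AffineGroup.trans g + act (AffineGroup.lin g) (coord l k).1,
      shearMul B (coord l g).2.1 (fun i => |(coord l g).2.2| ^ (-l i) * (coord l k).2.1 i),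
      (coord l g).2.2 * (coord l k).2.2) := by
  obtain ⟨ha, hg⟩ := hP.lin_eq g
  obtain ⟨hb, hk⟩ := hP.lin_eq k
  refine coord_of_lin_eq (B := B) (mul_ne_zero ha hb) ?_
  rw [← hP.dilationMatrix_mul _ _ ha, ← hg, ← hk]
  rfl

end IsShearletPresentation

end Coordinates

section Haar

variable {n : ℕ}

/-- The measure `|a|^{-(m + 1)} da` on the line. -/
def scaleMeasure (m : ℕ) : Measure ℝ :=
  volume.withDensity fun a => ENNReal.ofReal (|a| ^ (m + 1))⁻¹

instance (m : ℕ) : SigmaFinite (scaleMeasure m) := SigmaFinite.withDensity_ofReal _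

lemma measurable_scaleDensity (m : ℕ) :
    Measurable fun a : ℝ => ENNReal.ofReal (|a| ^ (m + 1))⁻¹ := by fun_prop

lemma map_mul_scaleMeasure (m : ℕ) {c : ℝ} (hc : c ≠ 0) :
    Measure.map (fun a => c * a) (scaleMeasure m) = ENNReal.ofReal (|c| ^ m) • scaleMeasure m := by
  have hm : Measurable fun a : ℝ => c * a := measurable_const_mul c
  have hp : 0 < |c| := abs_pos.2 hc
  ext A hA
  rw [Measure.map_apply hm hA, Measure.smul_apply, scaleMeasure, withDensity_apply _ (hm hA),
    withDensity_apply _ hA, ← lintegral_indicator (hm hA), ← lintegral_indicator hA]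
  have h1 : ∀ a : ℝ, ((fun a => c * a) ⁻¹' A).indicator
      (fun a => ENNReal.ofReal (|a| ^ (m + 1))⁻¹) a = ENNReal.ofReal (|c| ^ (m + 1)) *
        A.indicator (fun a => ENNReal.ofReal (|a| ^ (m + 1))⁻¹) (c * a) := by
    intro a
    by_cases h : c * a ∈ A
    · rw [Set.indicator_of_mem (show a ∈ (fun a => c * a) ⁻¹' A from h), Set.indicator_of_mem h,
        ← ENNReal.ofReal_mul (by positivity), abs_mul, mul_pow, mul_inv, ← mul_assoc,
        mul_inv_cancel₀ (by positivity), one_mul]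
    · rw [Set.indicator_of_notMem (show a ∉ (fun a => c * a) ⁻¹' A from h),
        Set.indicator_of_notMem h, mul_zero]
  have hmeas : Measurable (A.indicator fun a : ℝ => ENNReal.ofReal (|a| ^ (m + 1))⁻¹) :=
    (measurable_scaleDensity m).indicator hA
  simp only [h1]
  have hmeas' : Measurable fun a : ℝ =>
      A.indicator (fun a : ℝ => ENNReal.ofReal (|a| ^ (m + 1))⁻¹) (c * a) := hmeas.comp hm
  rw [lintegral_const_mul _ hmeas', ← lintegral_map hmeas hm,
    Real.map_volume_mul_left hc, lintegral_smul_measure, smul_eq_mul, smul_eq_mul, ← mul_assoc,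
    ← ENNReal.ofReal_mul (by positivity), abs_inv, pow_succ, mul_assoc, mul_inv_cancel₀ hp.ne',
    mul_one]

lemma scaleMeasure_singleton_zero (m : ℕ) : scaleMeasure m {0} = 0 :=
  withDensity_absolutelyContinuous _ _ (by simp)

lemma map_act_add {d : ℕ} (h : GL (Fin d) ℝ) (b : EuclideanSpace ℝ (Fin d)) :
    Measure.map (fun x => b + act h x) (volume : Measure (EuclideanSpace ℝ (Fin d))) =
      ENNReal.ofReal |(h : Matrix (Fin d) (Fin d) ℝ).det|⁻¹ • volume := by
  have h1 : (fun x => b + act h x) = (fun x => b + x) ∘ act h := rfl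
  have h2 := map_act h⁻¹
  rw [inv_inv, Matrix.coe_units_inv, Matrix.det_nonsing_inv, Ring.inverse_eq_inv, abs_inv] at h2
  rw [h1, ← Measure.map_map (measurable_const_add b) (continuous_act h).measurable, h2,
    Measure.map_smul, map_add_left_eq_self]

/-- The image of the left Haar measure of `ℝᵈ ⋊ H` in the coordinates `(b, s, a)`:
`|a|^{-(d + 1)} db ds da`, with `d = n + 1`. -/
def coordMeasure (n : ℕ) : Measure (Coord n) :=
  (volume : Measure (EuclideanSpace ℝ (Fin (n + 1)))).prod
    ((volume : Measure (Fin n → ℝ)).prod (scaleMeasure (n + 1)))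

lemma map_diagonal_mul {c : Fin n → ℝ} (hc : ∀ i, c i ≠ 0) :
    Measure.map (fun (s : Fin n → ℝ) i => c i * s i) volume =
      ENNReal.ofReal |(∏ i, c i)⁻¹| • volume := by
  have h : (Matrix.diagonal c).det ≠ 0 := by
    rw [Matrix.det_diagonal]; exact Finset.prod_ne_zero_iff.2 fun i _ => hc i
  have := Real.map_matrix_volume_pi_eq_smul_volume_pi h
  rw [Matrix.det_diagonal] at this
  rw [← this]
  congr 1
  ext s i
  simp [Matrix.mulVec_diagonal]

end Haar

namespace IsShearletPresentation

variable {n : ℕ} {B : (Fin n → ℝ) → Matrix (Fin n) (Fin n) ℝ} {l : Fin n → ℝ}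
  {H : Subgroup (GL (Fin (n + 1)) ℝ)}

/-- Left translation by `g` in the coordinates `(b, s, a)`. -/
def leftTranslation (B : (Fin n → ℝ) → Matrix (Fin n) (Fin n) ℝ) (l : Fin n → ℝ)
    (g : AffineGroup H) : Coord n → Coord n :=
  Prod.map (fun b => AffineGroup.trans g + act (AffineGroup.lin g) b)
    (Prod.map (fun s => shearMul B (coord l g).2.1 (fun i => |(coord l g).2.2| ^ (-l i) * s i))
      (fun a => (coord l g).2.2 * a))

lemma measurePreserving_leftTranslation (hP : IsShearletPresentation B l H) (g : AffineGroup H) :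
    MeasurePreserving (leftTranslation B l g) (coordMeasure n) (coordMeasure n) := by
  obtain ⟨ha, hg⟩ := hP.lin_eq g
  set s₀ := (coord l g).2.1
  set a := (coord l g).2.2
  have hpos : 0 < |a| := abs_pos.2 ha
  have hc : ∀ i, |a| ^ (-l i) ≠ 0 := fun i => (Real.rpow_pos_of_pos hpos _).ne'
  have hm1 : Measurable fun b => AffineGroup.trans g + act (AffineGroup.lin g) b :=
    ((continuous_act _).const_add _).measurable
  have hm3 : Measurable fun x : ℝ => a * x := measurable_const_mul a
  have hm2' : Measurable fun (s : Fin n → ℝ) i => |a| ^ (-l i) * s i :=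
    measurable_pi_lambda _ fun i => (measurable_pi_apply i).const_mul _
  have hT := hP.cocycle.measurePreserving_shearMul s₀
  have hm2 : Measurable fun s : Fin n → ℝ => shearMul B s₀ fun i => |a| ^ (-l i) * s i :=
    hT.measurable.comp hm2'
  have h2 : Measure.map (fun s : Fin n → ℝ => shearMul B s₀ fun i => |a| ^ (-l i) * s i) volume =
      ENNReal.ofReal |(∏ i, |a| ^ (-l i))⁻¹| • volume := by
    change Measure.map (shearMul B s₀ ∘ fun (s : Fin n → ℝ) i => |a| ^ (-l i) * s i) volume = _
    rw [← Measure.map_map hT.measurable hm2', map_diagonal_mul hc, Measure.map_smul, hT.map_eq]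
  refine ⟨hm1.prodMap (hm2.prodMap hm3), ?_⟩
  rw [leftTranslation, coordMeasure, ← Measure.map_prod_map _ _ hm1 (hm2.prodMap hm3),
    ← Measure.map_prod_map _ _ hm2 hm3, map_act_add, h2, map_mul_scaleMeasure _ ha]
  simp only [Measure.prod_smul_left, Measure.prod_smul_right, smul_smul]
  convert one_smul ℝ≥0∞ _
  rw [← ENNReal.ofReal_mul (by positivity), ← ENNReal.ofReal_mul (by positivity), hg,
    hP.cocycle.det_dilationMatrix, ENNReal.ofReal_eq_one, abs_mul, Finset.abs_prod, abs_inv,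
    Finset.abs_prod]
  simp only [abs_mul, Finset.prod_mul_distrib, Finset.prod_const, Finset.card_univ,
    Fintype.card_fin, Real.rpow_neg hpos.le, abs_inv, Finset.prod_inv_distrib, inv_inv]
  have : 0 < ∏ i, |(|a| ^ l i)| := Finset.prod_pos fun i _ =>
    abs_pos.2 (Real.rpow_pos_of_pos hpos _).ne'
  field_simp
  rw [pow_succ']

lemma ae_ne_zero_coordMeasure (n : ℕ) : ∀ᵐ p ∂coordMeasure n, p.2.2 ≠ 0 := by
  have h : {p : Coord n | ¬ p.2.2 ≠ 0} = Set.univ ×ˢ (Set.univ ×ˢ {0}) := by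
    ext p; simp
  rw [ae_iff, h, coordMeasure, Measure.prod_prod, Measure.prod_prod, scaleMeasure_singleton_zero,
    mul_zero, mul_zero]

/-- The left Haar measure `|a|^{-(d + 1)} db ds da` on `ℝᵈ ⋊ H`. -/
def haar (_hP : IsShearletPresentation B l H) : Measure (AffineGroup H) :=
  (coordMeasure n).comap (coord l)

lemma measurableEmbedding_coord (hP : IsShearletPresentation B l H) :
    MeasurableEmbedding (coord l : AffineGroup H → Coord n) :=
  hP.isOpenEmbedding_coord.measurableEmbedding

lemma map_coord_haar (hP : IsShearletPresentation B l H) :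
    Measure.map (coord l) hP.haar = coordMeasure n := by
  rw [haar, hP.measurableEmbedding_coord.map_comap, hP.range_coord]
  exact Measure.restrict_eq_self_of_ae_mem (ae_ne_zero_coordMeasure n)

lemma isMulLeftInvariant_haar (hP : IsShearletPresentation B l H) :
    hP.haar.IsMulLeftInvariant := by
  refine ⟨fun g => ?_⟩
  have hcoord := hP.measurableEmbedding_coord
  have hT := hP.measurePreserving_leftTranslation g
  have hmul : Measurable fun k : AffineGroup H => g * k := (continuous_const_mul g).measurable
  have h : coord l ∘ (fun k => g * k) = leftTranslation B l g ∘ coord l :=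
    funext fun k => hP.coord_mul g k
  rw [← hcoord.comap_map (Measure.map (fun k => g * k) hP.haar),
    Measure.map_map hcoord.measurable hmul, h, ← Measure.map_map hT.measurable hcoord.measurable,
    hP.map_coord_haar, hT.map_eq]
  rfl

lemma isFiniteMeasureOnCompacts_haar (hP : IsShearletPresentation B l H) :
    IsFiniteMeasureOnCompacts hP.haar := by
  refine ⟨fun K hK => ?_⟩
  have hcoord := hP.measurableEmbedding_coord
  have : T2Space (AffineGroup H) := hP.isOpenEmbedding_coord.isEmbedding.t2Space
  have hK' := hK.image hP.continuous_coord
  rw [haar, Measure.comap_apply _ hcoord.injective (fun A hA => hcoord.measurableSet_image.2 hA) _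
    hK.isClosed.measurableSet]
  set P := coord l '' K
  have hb := hK'.image continuous_fst
  have hs := hK'.image (continuous_fst.comp continuous_snd)
  have ha := hK'.image (continuous_snd.comp continuous_snd)
  have hsub : P ⊆
      (Prod.fst '' P) ×ˢ (((Prod.fst ∘ Prod.snd) '' P) ×ˢ ((Prod.snd ∘ Prod.snd) '' P)) :=
    fun p hp => ⟨⟨p, hp, rfl⟩, ⟨p, hp, rfl⟩, ⟨p, hp, rfl⟩⟩
  refine (measure_mono hsub).trans_lt ?_
  rw [coordMeasure, Measure.prod_prod, Measure.prod_prod]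
  refine ENNReal.mul_lt_top hb.measure_lt_top (ENNReal.mul_lt_top hs.measure_lt_top ?_)
  have h0 : ∀ x ∈ (Prod.snd ∘ Prod.snd) '' P, x ≠ (0 : ℝ) := by
    rintro _ ⟨_, ⟨g, -, rfl⟩, rfl⟩
    exact (hP.lin_eq g).1
  rw [scaleMeasure, withDensity_apply _ ha.measurableSet]
  have hcont : ContinuousOn (fun x : ℝ => (|x| ^ (n + 1 + 1))⁻¹) ((Prod.snd ∘ Prod.snd) '' P) :=
    ContinuousOn.inv₀ (by fun_prop) fun x hx => by have := h0 x hx; positivity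
  obtain ⟨C, hC⟩ := ha.exists_bound_of_continuousOn hcont
  refine (setLIntegral_mono (g := fun _ => ENNReal.ofReal C) measurable_const fun x hx =>
    ENNReal.ofReal_le_ofReal ((le_abs_self _).trans (hC x hx))).trans_lt ?_
  rw [setLIntegral_const]
  exact ENNReal.mul_lt_top ENNReal.ofReal_lt_top ha.measure_lt_top

lemma haar_ne_zero (hP : IsShearletPresentation B l H) : hP.haar ≠ 0 := by
  intro h
  have h1 := hP.map_coord_haar
  rw [h, Measure.map_zero] at h1
  have h2 : coordMeasure n (Set.univ ×ˢ (Set.univ ×ˢ Set.Icc 1 2)) = 0 := by rw [← h1]; simp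
  rw [coordMeasure, Measure.prod_prod, Measure.prod_prod] at h2
  have h3 : scaleMeasure (n + 1) (Set.Icc 1 2) ≠ 0 := by
    rw [scaleMeasure, withDensity_apply _ measurableSet_Icc,
      Ne, setLIntegral_eq_zero_iff measurableSet_Icc (measurable_scaleDensity _)]
    intro h
    have h4 : volume (Set.Icc (1 : ℝ) 2) = 0 := by
      refine measure_mono_null (fun x hx => ?_) (ae_iff.1 h)
      intro hx'
      have := hx' hx
      have hx0 : 0 < x := lt_of_lt_of_le one_pos hx.1
      rw [ENNReal.ofReal_eq_zero] at this
      have : 0 < (|x| ^ (n + 1 + 1))⁻¹ := by positivity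
      linarith
    rw [Real.volume_Icc] at h4
    norm_num at h4
  simp only [mul_eq_zero, h3, or_false] at h2
  rcases h2 with h2 | h2
  · exact isOpen_univ.measure_ne_zero volume Set.univ_nonempty h2
  · exact isOpen_univ.measure_ne_zero volume Set.univ_nonempty h2

/-- By uniqueness of Haar measure, `μ` is a positive multiple of the explicit Haar measure. -/
lemma exists_eq_smul_haar (hP : IsShearletPresentation B l H) (μ : Measure (AffineGroup H))
    [μ.IsHaarMeasure] : ∃ c : ℝ≥0, c ≠ 0 ∧ μ = c • hP.haar := by
  have := hP.secondCountableTopology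
  have := hP.locallyCompactSpace
  have := hP.isFiniteMeasureOnCompacts_haar
  have := hP.isMulLeftInvariant_haar
  have h := Measure.isMulLeftInvariant_eq_smul hP.haar μ
  set c := Measure.haarScalarFactor hP.haar μ
  have hc : c ≠ 0 := fun hc => hP.haar_ne_zero (by rw [h, hc, zero_smul])
  refine ⟨c⁻¹, inv_ne_zero hc, ?_⟩
  rw [h, smul_smul, inv_mul_cancel₀ hc, one_smul]

end IsShearletPresentation

/-! ### The voice transform on the Fourier side -/

section FourierSide

variable {d : ℕ} {H : Subgroup (GL (Fin d) ℝ)}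

/-- The transpose of an invertible matrix, as an invertible matrix. -/
def transposeGL (h : GL (Fin d) ℝ) : GL (Fin d) ℝ :=
  Matrix.GeneralLinearGroup.mkOfDetNeZero (h : Matrix (Fin d) (Fin d) ℝ).transpose
    (by rw [Matrix.det_transpose]; exact (Matrix.isUnits_det_units h).ne_zero)

lemma coe_transposeGL (h : GL (Fin d) ℝ) :
    (transposeGL h : Matrix (Fin d) (Fin d) ℝ) = (h : Matrix (Fin d) (Fin d) ℝ).transpose := rfl

lemma inner_act (h : GL (Fin d) ℝ) (x y : EuclideanSpace ℝ (Fin d)) :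
    inner ℝ (act h x) y = inner ℝ x (act (transposeGL h) y) := by
  simp only [act, coe_transposeGL, Matrix.toLpLin_apply, EuclideanSpace.inner_eq_star_dotProduct,
    star_trivial]
  rw [Matrix.dotProduct_mulVec, Matrix.mulVec_transpose]

/-- The element `(0, (hᵀ)⁻¹)` of the full affine group, which acts on functions by
`f ↦ |det h|^{1/2} f(hᵀ ·)`. -/
def dualElement (h : GL (Fin d) ℝ) : AffineGroup (⊤ : Subgroup (GL (Fin d) ℝ)) :=
  ⟨Multiplicative.ofAdd 0, ⟨(transposeGL h)⁻¹, trivial⟩⟩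

lemma invAct_dualElement (h : GL (Fin d) ℝ) (ξ : EuclideanSpace ℝ (Fin d)) :
    invAct (dualElement h) ξ = act (transposeGL h) ξ := by
  have h1 : AffineGroup.lin (dualElement h) = (transposeGL h)⁻¹ := rfl
  have h2 : AffineGroup.trans (dualElement h) = 0 := rfl
  rw [invAct, h1, h2, inv_inv, sub_zero]

lemma normFactor_dualElement (h : GL (Fin d) ℝ) :
    normFactor (AffineGroup.lin (dualElement h)) =
      |(h : Matrix (Fin d) (Fin d) ℝ).det| ^ (1 / 2 : ℝ) := by
  have h1 : AffineGroup.lin (dualElement h) = (transposeGL h)⁻¹ := rfl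
  rw [normFactor, h1, Matrix.coe_units_inv, Matrix.det_nonsing_inv, Ring.inverse_eq_inv, abs_inv,
    coe_transposeGL, Matrix.det_transpose, Real.inv_rpow (abs_nonneg _),
    Real.rpow_neg (abs_nonneg _), inv_inv]

lemma act_invAct_add (g : AffineGroup H) (x : EuclideanSpace ℝ (Fin d)) :
    act (AffineGroup.lin g) (invAct g x) + AffineGroup.trans g = x := by
  rw [invAct, act_act_inv, sub_add_cancel]

lemma integral_comp_invAct (g : AffineGroup H) {Φ : EuclideanSpace ℝ (Fin d) → ℂ}
    (hΦ : Continuous Φ) :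
    ∫ x, Φ (invAct g x) = |(AffineGroup.lin g : Matrix (Fin d) (Fin d) ℝ).det| • ∫ y, Φ y := by
  rw [← integral_map (continuous_invAct g).measurable.aemeasurable hΦ.aestronglyMeasurable,
    map_invAct, integral_smul_measure, ENNReal.toReal_ofReal (abs_nonneg _)]

lemma integrable_quasiRegularFun (g : AffineGroup H) {V : EuclideanSpace ℝ (Fin d) → ℂ}
    (hV : Integrable V) : Integrable (quasiRegularFun g V) := by
  refine Integrable.const_mul ?_ _
  refine Integrable.comp_measurable (g := V) ?_ (continuous_invAct g).measurable
  rw [map_invAct]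
  exact hV.smul_measure ENNReal.ofReal_ne_top

/-- The Fourier integral of `|det h|^{-1/2} V(h⁻¹(· - b))`. -/
lemma fourier_quasiRegularFun (g : AffineGroup H) {V : EuclideanSpace ℝ (Fin d) → ℂ}
    (hV : Continuous V) (ξ : EuclideanSpace ℝ (Fin d)) :
    𝓕 (quasiRegularFun g V) ξ = Real.fourierChar (-inner ℝ (AffineGroup.trans g) ξ) •
      quasiRegularFun (dualElement (AffineGroup.lin g)) (𝓕 V) ξ := by
  set D := |(AffineGroup.lin g : Matrix (Fin d) (Fin d) ℝ).det| with hD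
  have hDpos : 0 < D := abs_det_pos _
  let Φ : EuclideanSpace ℝ (Fin d) → ℂ := fun y =>
    Real.fourierChar (-inner ℝ (act (AffineGroup.lin g) y + AffineGroup.trans g) ξ) •
      ((normFactor (AffineGroup.lin g) : ℂ) * V y)
  have hΦ : Continuous Φ := by
    have h1 : Continuous fun y => -inner ℝ (act (AffineGroup.lin g) y + AffineGroup.trans g) ξ :=
      (((continuous_act _).add_const _).inner continuous_const).neg
    exact (Real.continuous_fourierChar.comp h1).smul (continuous_const.mul hV)
  have h1 : 𝓕 (quasiRegularFun g V) ξ = ∫ x, Φ (invAct g x) := by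
    rw [Real.fourier_eq]
    refine integral_congr_ae (Filter.Eventually.of_forall fun x => ?_)
    simp only [Φ, act_invAct_add, quasiRegularFun]
  have h2 : ∀ y, Φ y = Real.fourierChar (-inner ℝ (AffineGroup.trans g) ξ) •
      ((normFactor (AffineGroup.lin g) : ℂ) •
        (Real.fourierChar (-inner ℝ y (act (transposeGL (AffineGroup.lin g)) ξ)) • V y)) := by
    intro y
    simp only [Φ, inner_add_left, inner_act, neg_add, AddChar.map_add_eq_mul, Circle.smul_def,
      Circle.coe_mul, smul_eq_mul]
    ring
  rw [h1, integral_comp_invAct g hΦ]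
  simp only [h2]
  have h3 : D * normFactor (AffineGroup.lin g) = D ^ (1 / 2 : ℝ) := by
    rw [normFactor, ← hD]
    nth_rewrite 1 [← Real.rpow_one D]
    rw [← Real.rpow_add hDpos]
    norm_num
  rw [quasiRegularFun, normFactor_dualElement, ← hD, ← h3, invAct_dualElement, Real.fourier_eq]
  simp only [Circle.smul_def]
  rw [integral_smul, integral_smul]
  simp only [Complex.real_smul, smul_eq_mul, Complex.ofReal_mul]
  ring

lemma memLp_modulation (b : EuclideanSpace ℝ (Fin d)) (f : L2 d) :
    MemLp (fun ξ => Real.fourierChar (-inner ℝ b ξ) • f ξ) 2 volume := by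
  have hc : Continuous fun ξ : EuclideanSpace ℝ (Fin d) => Real.fourierChar (-inner ℝ b ξ) :=
    Real.continuous_fourierChar.comp (continuous_const.inner continuous_id).neg
  refine (Lp.memLp f).of_le ?_ (Filter.Eventually.of_forall fun ξ => ?_)
  · simp only [Circle.smul_def]
    exact (continuous_subtype_val.comp hc).aestronglyMeasurable.smul (Lp.aestronglyMeasurable f)
  · rw [Circle.norm_smul]

/-- Modulation `f ↦ e^{-2πi ⟨b, ·⟩} f` on `L²(ℝᵈ)`. -/
def modulation (b : EuclideanSpace ℝ (Fin d)) (f : L2 d) : L2 d := (memLp_modulation b f).toLp _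

lemma coeFn_modulation (b : EuclideanSpace ℝ (Fin d)) (f : L2 d) :
    modulation b f =ᵐ[volume] fun ξ => Real.fourierChar (-inner ℝ b ξ) • f ξ :=
  MemLp.coeFn_toLp _

lemma isometry_modulation (b : EuclideanSpace ℝ (Fin d)) : Isometry (modulation b) := by
  refine Isometry.of_dist_eq fun f₁ f₂ => ?_
  have h : ‖modulation b f₁ - modulation b f₂‖ = ‖f₁ - f₂‖ := by
    rw [Lp.norm_def, Lp.norm_def]
    congr 1
    refine eLpNorm_congr_norm_ae ?_
    filter_upwards [coeFn_modulation b f₁, coeFn_modulation b f₂,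
      Lp.coeFn_sub (modulation b f₁) (modulation b f₂), Lp.coeFn_sub f₁ f₂] with ξ h1 h2 h3 h4
    rw [h3, h4, Pi.sub_apply, Pi.sub_apply, h1, h2, ← smul_sub, Circle.norm_smul]
  rw [dist_eq_norm, dist_eq_norm, h]

/-- On the Fourier side `(b, h)` acts by `|det h|^{1/2} e^{-2πi ⟨b, ·⟩} f(hᵀ ·)`. -/
lemma fourier_quasiRegularOp (g : AffineGroup H) (ψ : L2 d) :
    𝓕 (quasiRegularOp g ψ) = modulation (AffineGroup.trans g)
      (quasiRegularOp (dualElement (AffineGroup.lin g)) (𝓕 ψ)) := by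
  have hc1 : Continuous fun ψ : L2 d => 𝓕 (quasiRegularOp g ψ) :=
    (Lp.fourierTransformₗᵢ (EuclideanSpace ℝ (Fin d)) ℂ).continuous.comp
      (quasiRegular H g).continuous
  have hc2 : Continuous fun ψ : L2 d => modulation (AffineGroup.trans g)
      (quasiRegularOp (dualElement (AffineGroup.lin g)) (𝓕 ψ)) :=
    (isometry_modulation _).continuous.comp ((quasiRegular ⊤ _).continuous.comp
      (Lp.fourierTransformₗᵢ (EuclideanSpace ℝ (Fin d)) ℂ).continuous)
  refine congrFun ((SchwartzMap.denseRange_toLpCLM (E := EuclideanSpace ℝ (Fin d)) (F := ℂ)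
    (p := 2) (μ := volume) ENNReal.ofNat_ne_top).equalizer hc1 hc2 (funext fun V => ?_)) ψ
  simp only [Function.comp_apply, SchwartzMap.toLpCLM_apply]
  have hV : quasiRegularFun g (V.toLp 2 : L2 d) =ᵐ[volume] quasiRegularFun g V :=
    quasiRegularFun_congr g (V.coeFn_toLp 2 volume)
  have hmem : MemLp (quasiRegularFun g V) 2 volume :=
    (memLp_congr_ae hV).1 (memLp_quasiRegularFun g _)
  have h1 : quasiRegularOp g (V.toLp 2 : L2 d) = hmem.toLp _ :=
    Lp.ext ((coeFn_quasiRegularOp _ _).trans (hV.trans hmem.coeFn_toLp.symm))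
  rw [h1, SchwartzMap.toLp_fourier_eq]
  refine Lp.ext ((coeFn_fourier_toLp (integrable_quasiRegularFun g V.integrable) hmem).trans ?_)
  have h2 := (coeFn_quasiRegularOp (dualElement (AffineGroup.lin g)) ((𝓕 V).toLp 2 : L2 d)).trans
    (quasiRegularFun_congr _ ((𝓕 V).coeFn_toLp 2 volume))
  filter_upwards [coeFn_modulation (AffineGroup.trans g)
    (quasiRegularOp (dualElement (AffineGroup.lin g)) ((𝓕 V).toLp 2 : L2 d)), h2] with ξ h3 h4
  rw [h3, h4, fourier_quasiRegularFun g V.continuous, SchwartzMap.fourier_coe]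

/-- The function `|det h|^{1/2} conj(ψ̂(hᵀ ξ)) f̂(ξ)`, whose inverse Fourier integral at `b` is the
voice transform at `(b, h)`. -/
def voiceSymbol (h : GL (Fin d) ℝ) (ψ f : L2 d) (ξ : EuclideanSpace ℝ (Fin d)) : ℂ :=
  star (quasiRegularFun (dualElement h) (𝓕 ψ : L2 d) ξ) * (𝓕 f : L2 d) ξ

lemma integrable_voiceSymbol (h : GL (Fin d) ℝ) (ψ f : L2 d) : Integrable (voiceSymbol h ψ f) :=
  (memLp_quasiRegularFun (dualElement h) (𝓕 ψ)).star.integrable_mul (Lp.memLp _)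

lemma voice_eq_fourierInv (g : AffineGroup H) (ψ f : L2 d) :
    voice (quasiRegular H) ψ f g =
      𝓕⁻ (voiceSymbol (AffineGroup.lin g) ψ f) (AffineGroup.trans g) := by
  have h1 : voice (quasiRegular H) ψ f g = inner ℂ (𝓕 (quasiRegularOp g ψ)) (𝓕 f) :=
    (Lp.inner_fourier_eq (quasiRegularOp g ψ) f).symm
  rw [h1, fourier_quasiRegularOp, L2.inner_def, Real.fourierInv_eq]
  refine integral_congr_ae ?_
  filter_upwards [coeFn_modulation (AffineGroup.trans g)
    (quasiRegularOp (dualElement (AffineGroup.lin g)) (𝓕 ψ)),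
    coeFn_quasiRegularOp (dualElement (AffineGroup.lin g)) (𝓕 ψ)] with ξ h2 h3
  rw [h2, h3, voiceSymbol, real_inner_comm]
  simp only [Circle.smul_def, smul_eq_mul, RCLike.inner_apply, map_mul, AddChar.map_neg_eq_inv,
    Circle.coe_inv_eq_conj, Complex.conj_conj, RCLike.star_def]
  ring

lemma lintegral_fourierInv_voiceSymbol (h : GL (Fin d) ℝ) (ψ f : L2 d) :
    ∫⁻ b, ‖𝓕⁻ (voiceSymbol h ψ f) b‖ₑ ^ 2 =
      ∫⁻ ξ, ENNReal.ofReal |(h : Matrix (Fin d) (Fin d) ℝ).det| *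
        ‖(𝓕 ψ : L2 d) (act (transposeGL h) ξ)‖ₑ ^ 2 * ‖(𝓕 f : L2 d) ξ‖ₑ ^ 2 := by
  rw [lintegral_enorm_sq_fourierInv (integrable_voiceSymbol h ψ f)]
  refine lintegral_congr fun ξ => ?_
  have hp := abs_det_pos h
  have h1 : ‖(normFactor (AffineGroup.lin (dualElement h)) : ℂ)‖ₑ ^ 2 =
      ENNReal.ofReal |(h : Matrix (Fin d) (Fin d) ℝ).det| := by
    rw [normFactor_dualElement, ← ofReal_norm, Complex.norm_real,
      Real.norm_of_nonneg (by positivity), ← ENNReal.ofReal_pow (by positivity),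
      ← Real.rpow_natCast, ← Real.rpow_mul hp.le]
    norm_num
  have h2 : ∀ z : ℂ, ‖star z‖ₑ = ‖z‖ₑ := fun z => by
    rw [← ofReal_norm, ← ofReal_norm, norm_star]
  rw [voiceSymbol, quasiRegularFun, invAct_dualElement, star_mul', enorm_mul, enorm_mul, mul_pow,
    mul_pow, h2, h2, h1]

end FourierSide

/-! ### Strong continuity of the quasi-regular representation -/

section StrongContinuity

variable {d : ℕ} {H : Subgroup (GL (Fin d) ℝ)}

lemma continuous_normFactor_lin :
    Continuous fun g : AffineGroup H => normFactor (AffineGroup.lin g) := by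
  have h1 : Continuous fun g : AffineGroup H =>
      |(AffineGroup.lin g : Matrix (Fin d) (Fin d) ℝ).det| :=
    (Units.continuous_val.comp AffineGroup.continuous_lin).matrix_det.abs
  exact h1.rpow_const fun g => Or.inl (abs_det_pos _).ne'

lemma continuous_invAct_left (x : EuclideanSpace ℝ (Fin d)) :
    Continuous fun g : AffineGroup H => invAct g x := by
  have h1 : Continuous fun g : AffineGroup H =>
      ((AffineGroup.lin g)⁻¹, x - AffineGroup.trans g) :=
    AffineGroup.continuous_lin.inv.prodMk (continuous_const.sub AffineGroup.continuous_trans)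
  simpa only [Function.comp_def] using! (continuous_act_uncurry (d := d)).comp h1

/-- Matrix coefficients of a bounded continuous vector against an integrable one are continuous, by
dominated convergence. -/
lemma continuous_inner_quasiRegularOp [FirstCountableTopology (AffineGroup H)] {v w : L2 d}
    {V W : EuclideanSpace ℝ (Fin d) → ℂ} (hv : v =ᵐ[volume] V) (hw : w =ᵐ[volume] W)
    (hV : Continuous V) {C : ℝ} (hC : ∀ x, ‖V x‖ ≤ C) (hW : Integrable W) :
    Continuous fun g : AffineGroup H => inner ℂ (quasiRegularOp g v) w := by
  have h : ∀ g : AffineGroup H, inner ℂ (quasiRegularOp g v) w =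
      (normFactor (AffineGroup.lin g) : ℂ) * ∫ x, W x * star (V (invAct g x)) := by
    intro g
    rw [L2.inner_def, ← integral_const_mul]
    refine integral_congr_ae ?_
    filter_upwards [(coeFn_quasiRegularOp g v).trans (quasiRegularFun_congr g hv), hw]
      with x h1 h2
    rw [h1, h2, quasiRegularFun]
    simp only [RCLike.inner_apply, map_mul, RCLike.star_def, Complex.conj_ofReal]
    ring
  simp only [h]
  refine (Complex.continuous_ofReal.comp continuous_normFactor_lin).mul ?_
  refine continuous_of_dominated (bound := fun x => ‖W x‖ * C) (fun g => ?_) (fun g => ?_) ?_ ?_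
  · exact hW.1.mul (continuous_star.comp (hV.comp (continuous_invAct g))).aestronglyMeasurable
  · refine Filter.Eventually.of_forall fun x => ?_
    rw [norm_mul, norm_star]
    exact mul_le_mul_of_nonneg_left (hC _) (norm_nonneg _)
  · exact hW.norm.mul_const C
  · exact Filter.Eventually.of_forall fun x =>
      continuous_const.mul (continuous_star.comp (hV.comp (continuous_invAct_left x)))

lemma continuous_quasiRegularOp_schwartz [FirstCountableTopology (AffineGroup H)]
    (V : SchwartzMap (EuclideanSpace ℝ (Fin d)) ℂ) :
    Continuous fun g : AffineGroup H => quasiRegularOp g (V.toLp 2 : L2 d) := by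
  set v : L2 d := V.toLp 2
  have hv : v =ᵐ[volume] V := V.coeFn_toLp 2 volume
  obtain ⟨C, hC⟩ : ∃ C, ∀ x, ‖V x‖ ≤ C :=
    ⟨_, fun x => SchwartzMap.norm_le_seminorm ℝ V x⟩
  refine continuous_iff_continuousAt.2 fun g₀ => ?_
  have hw := (coeFn_quasiRegularOp g₀ v).trans (quasiRegularFun_congr g₀ hv)
  have hc := continuous_inner_quasiRegularOp (H := H) hv hw V.continuous hC
    (integrable_quasiRegularFun g₀ V.integrable)
  -- weak convergence of vectors of constant norm is strong convergence
  have h1 : ∀ g : AffineGroup H, ‖quasiRegularOp g v - quasiRegularOp g₀ v‖ ^ 2 =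
      ‖v‖ ^ 2 - 2 * RCLike.re (inner ℂ (quasiRegularOp g v) (quasiRegularOp g₀ v)) + ‖v‖ ^ 2 := by
    intro g
    rw [norm_sub_sq (𝕜 := ℂ), norm_quasiRegularOp, norm_quasiRegularOp]
  have h2 : Continuous fun g : AffineGroup H =>
      ‖quasiRegularOp g v - quasiRegularOp g₀ v‖ ^ 2 := by
    simp only [h1]
    exact (continuous_const.sub (continuous_const.mul (RCLike.continuous_re.comp hc))).add
      continuous_const
  have h3 := (h2.sqrt).tendsto g₀
  simp only [Real.sqrt_sq (norm_nonneg _), sub_self, norm_zero, Real.sqrt_sq le_rfl] at h3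
  exact tendsto_iff_norm_sub_tendsto_zero.2 h3

lemma continuous_quasiRegular [FirstCountableTopology (AffineGroup H)] (v : L2 d) :
    Continuous fun g : AffineGroup H => quasiRegular H g v := by
  refine continuous_of_uniform_approx_of_continuous fun u hu => ?_
  obtain ⟨ε, hε, hεu⟩ := Metric.mem_uniformity_dist.1 hu
  obtain ⟨V, hV⟩ := (SchwartzMap.denseRange_toLpCLM (E := EuclideanSpace ℝ (Fin d)) (F := ℂ)
    (p := 2) (μ := volume) ENNReal.ofNat_ne_top).exists_dist_lt v hε
  refine ⟨_, continuous_quasiRegularOp_schwartz V, fun g => hεu ?_⟩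
  have := (quasiRegular H g).isometry.dist_eq v (V.toLp 2 : L2 d)
  exact this.trans_lt hV

end StrongContinuity

/-! ### The orbit integral -/

section OrbitIntegral

variable {n : ℕ} {B : (Fin n → ℝ) → Matrix (Fin n) (Fin n) ℝ} {l : Fin n → ℝ}

/-- The vector with first coordinate `x` and remaining coordinates `y`. -/
def consVec (x : ℝ) (y : Fin n → ℝ) : EuclideanSpace ℝ (Fin (n + 1)) :=
  WithLp.toLp 2 (Fin.cons x y)

lemma measurable_consVec :
    Measurable fun p : ℝ × (Fin n → ℝ) => consVec p.1 p.2 := by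
  refine (WithLp.measurable_toLp 2 _).comp (measurable_pi_lambda _ fun i => ?_)
  refine Fin.cases ?_ (fun i => ?_) i
  · simpa using measurable_fst
  · simpa [Function.comp_def] using (measurable_pi_apply i).comp measurable_snd

lemma lintegral_eq_lintegral_consVec {G : EuclideanSpace ℝ (Fin (n + 1)) → ℝ≥0∞}
    (hG : Measurable G) : ∫⁻ ξ, G ξ = ∫⁻ x, ∫⁻ y, G (consVec x y) := by
  have hG' : Measurable fun v : Fin (n + 1) → ℝ => G (WithLp.toLp 2 v) :=
    hG.comp (WithLp.measurable_toLp 2 _)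
  rw [← (PiLp.volume_preserving_toLp (Fin (n + 1))).lintegral_comp hG,
    ← (volume_preserving_piFinSuccAbove (fun _ : Fin (n + 1) => ℝ) 0).symm.lintegral_comp hG',
    Measure.volume_eq_prod]
  refine (lintegral_prod _ (hG'.comp (MeasurableEquiv.measurable _)).aemeasurable).trans ?_
  refine lintegral_congr fun x => lintegral_congr fun y => ?_
  rw [consVec, ← Fin.insertNth_zero']
  rfl

lemma lintegral_scaleMeasure (m : ℕ) {g : ℝ → ℝ≥0∞} (hg : Measurable g) :
    ∫⁻ a, g a ∂scaleMeasure m = ∫⁻ a, ENNReal.ofReal (|a| ^ (m + 1))⁻¹ * g a := by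
  rw [scaleMeasure, lintegral_withDensity_eq_lintegral_mul _ (measurable_scaleDensity m) hg]
  rfl

/-- The vector `h ᵀ ξ` for `h = σ(s) δ(a)`. -/
def dualOrbit (B : (Fin n → ℝ) → Matrix (Fin n) (Fin n) ℝ) (l s : Fin n → ℝ) (a : ℝ)
    (ξ : EuclideanSpace ℝ (Fin (n + 1))) : EuclideanSpace ℝ (Fin (n + 1)) :=
  WithLp.toLp 2 ((dilationMatrix B l s a).transpose.mulVec (WithLp.ofLp ξ))

/-- Off the hyperplane `ξ₁ = 0`, the shearing parameter enters `hᵀ ξ` through a left translation of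
the shearing group. -/
lemma dualOrbit_eq (s : Fin n → ℝ) (a : ℝ) {ξ : EuclideanSpace ℝ (Fin (n + 1))} (hξ : ξ 0 ≠ 0) :
    dualOrbit B l s a ξ = consVec (ξ 0 * a) fun j => -(ξ 0 * (a * |a| ^ l j)) *
      shearMul B (fun i => -(ξ i.succ / ξ 0)) s j := by
  rw [dualOrbit, consVec]
  congr 1
  ext j
  rw [Matrix.mulVec, dotProduct, Fin.sum_univ_succ]
  refine Fin.cases ?_ (fun j => ?_) j
  · simp [Matrix.transpose_apply, dilationMatrix_zero_zero, dilationMatrix_succ_zero, mul_comm]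
  · simp only [Matrix.transpose_apply, dilationMatrix_zero_succ, dilationMatrix_succ_succ,
      Fin.cons_succ, shearMul, Pi.add_apply, Matrix.vecMul, dotProduct, mul_add, Finset.mul_sum]
    congr 1
    · ring
    · refine Finset.sum_congr rfl fun i _ => ?_
      field_simp

lemma measurable_dilationMatrix (hB : IsShearCocycle B) (i j : Fin (n + 1)) :
    Measurable fun q : (Fin n → ℝ) × ℝ => dilationMatrix B l q.1 q.2 i j := by
  have hl : ∀ j, Measurable fun q : (Fin n → ℝ) × ℝ => q.2 * |q.2| ^ l j := fun j => by fun_prop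
  refine Fin.cases ?_ (fun i => ?_) i <;> refine Fin.cases ?_ (fun j => ?_) j
  · simpa only [dilationMatrix_zero_zero] using measurable_snd
  · simp only [dilationMatrix_zero_succ]
    exact ((measurable_pi_apply j).comp measurable_fst).neg.mul (hl j)
  · simp only [dilationMatrix_succ_zero]
    exact measurable_const
  · simp only [dilationMatrix_succ_succ]
    exact ((hB.continuous_entry i j).measurable.comp measurable_fst).mul (hl j)

lemma measurable_dualOrbit (hB : IsShearCocycle B) :
    Measurable fun p : ((Fin n → ℝ) × ℝ) × EuclideanSpace ℝ (Fin (n + 1)) =>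
      dualOrbit B l p.1.1 p.1.2 p.2 := by
  refine (WithLp.measurable_toLp 2 _).comp (measurable_pi_lambda _ fun j => ?_)
  simp only [Matrix.mulVec, dotProduct, Matrix.transpose_apply]
  refine Finset.measurable_sum _ fun i _ => ?_
  exact ((measurable_dilationMatrix hB i j).comp measurable_fst).mul
    (((measurable_pi_apply i).comp (WithLp.measurable_ofLp 2 _)).comp measurable_snd)

lemma lintegral_dualOrbit_shear (hB : IsShearCocycle B)
    {G : EuclideanSpace ℝ (Fin (n + 1)) → ℝ≥0∞} (hG : Measurable G)
    {ξ : EuclideanSpace ℝ (Fin (n + 1))} (hξ : ξ 0 ≠ 0) {a : ℝ} (ha : a ≠ 0) :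
    ∫⁻ s : Fin n → ℝ, ENNReal.ofReal |(dilationMatrix B l s a).det| * G (dualOrbit B l s a ξ) =
      ENNReal.ofReal (|a| * (|ξ 0| ^ n)⁻¹) * ∫⁻ y : Fin n → ℝ, G (consVec (ξ 0 * a) y) := by
  have hξp : 0 < |ξ 0| := abs_pos.2 hξ
  have hap : 0 < |a| := abs_pos.2 ha
  -- the last `n` coordinates of `hᵀ ξ` are `c j * (t * s) j`, where `t` depends on `ξ` only
  let c : Fin n → ℝ := fun j => -(ξ 0 * (a * |a| ^ l j))
  have hc : ∀ j, c j ≠ 0 := fun j => neg_ne_zero.2 (mul_ne_zero hξ (mul_ne_zero ha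
    (Real.rpow_pos_of_pos hap _).ne'))
  have hGa : Measurable fun y : Fin n → ℝ => G (consVec (ξ 0 * a) y) :=
    hG.comp (measurable_consVec.comp measurable_prodMk_left)
  have hm : Measurable fun (s : Fin n → ℝ) i => c i * s i :=
    measurable_pi_lambda _ fun i => (measurable_pi_apply i).const_mul _
  have hGm : Measurable fun s : Fin n → ℝ => G (consVec (ξ 0 * a) fun i => c i * s i) :=
    hGa.comp hm
  have h1 := (hB.measurePreserving_shearMul fun i => -(ξ i.succ / ξ 0)).lintegral_comp hGm
  have h2 : ∫⁻ s : Fin n → ℝ, G (consVec (ξ 0 * a) fun i => c i * s i) =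
      ENNReal.ofReal |(∏ i, c i)⁻¹| * ∫⁻ y : Fin n → ℝ, G (consVec (ξ 0 * a) y) := by
    rw [← lintegral_map hGa hm, map_diagonal_mul hc, lintegral_smul_measure, smul_eq_mul]
  simp only [hB.det_dilationMatrix, dualOrbit_eq _ a hξ]
  rw [lintegral_const_mul' _ _ ENNReal.ofReal_ne_top, h1, h2, ← mul_assoc,
    ← ENNReal.ofReal_mul (abs_nonneg _)]
  congr 2
  simp only [c, abs_mul, abs_inv, Finset.abs_prod, abs_neg, Finset.prod_mul_distrib,
    Finset.prod_const, Finset.card_univ, Fintype.card_fin, abs_pow]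
  have : 0 < ∏ i, |(|a| ^ l i)| := Finset.prod_pos fun i _ =>
    abs_pos.2 (Real.rpow_pos_of_pos hap _).ne'
  field_simp

lemma ae_ne_zero_scaleMeasure (m : ℕ) : ∀ᵐ a ∂scaleMeasure m, a ≠ 0 := by
  have h : {a : ℝ | ¬ a ≠ 0} = {0} := by ext; simp
  rw [ae_iff, h, scaleMeasure_singleton_zero]

/-- The orbit integral `∫ |det h| G(hᵀ ξ) dh` against `|a|^{-(d + 1)} ds da` does not depend on `ξ`
off the hyperplane `ξ₁ = 0`, and equals `∫ G(η) |η₁|^{-d} dη`. -/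
lemma lintegral_dualOrbit (hB : IsShearCocycle B) {G : EuclideanSpace ℝ (Fin (n + 1)) → ℝ≥0∞}
    (hG : Measurable G) {ξ : EuclideanSpace ℝ (Fin (n + 1))} (hξ : ξ 0 ≠ 0) :
    ∫⁻ q, ENNReal.ofReal |(dilationMatrix B l q.1 q.2).det| * G (dualOrbit B l q.1 q.2 ξ)
        ∂((volume : Measure (Fin n → ℝ)).prod (scaleMeasure (n + 1))) =
      ∫⁻ η, G η / ‖η 0‖ₑ ^ (n + 1) := by
  let g : ℝ → ℝ≥0∞ := fun x => ∫⁻ y : Fin n → ℝ, G (consVec x y)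
  have hg : Measurable g := (hG.comp measurable_consVec :
    Measurable fun p : ℝ × (Fin n → ℝ) => G (consVec p.1 p.2)).lintegral_prod_right'
  have hξp : 0 < |ξ 0| := abs_pos.2 hξ
  have hdet : Measurable fun q : (Fin n → ℝ) × ℝ =>
      ENNReal.ofReal |(dilationMatrix B l q.1 q.2).det| := by
    simp only [hB.det_dilationMatrix]
    fun_prop
  have hdo' : Measurable fun q : (Fin n → ℝ) × ℝ => dualOrbit B l q.1 q.2 ξ := by
    have h1 : Measurable fun q : (Fin n → ℝ) × ℝ => (q, ξ) := measurable_id.prodMk measurable_const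
    simpa only [Function.comp_def] using (measurable_dualOrbit (l := l) hB).comp h1
  have horb : Measurable fun q : (Fin n → ℝ) × ℝ => G (dualOrbit B l q.1 q.2 ξ) :=
    hG.comp hdo'
  have hne : ∀ᵐ a : ℝ, a ≠ 0 := by simp [ae_iff]
  have hGd : Measurable fun η : EuclideanSpace ℝ (Fin (n + 1)) => G η / ‖η 0‖ₑ ^ (n + 1) := by
    have h0 : Measurable fun η : EuclideanSpace ℝ (Fin (n + 1)) => η 0 :=
      (measurable_pi_apply 0).comp (WithLp.measurable_ofLp 2 _)
    exact hG.div (h0.enorm.pow_const _)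
  have hdo : Measurable fun q : (Fin n → ℝ) × ℝ =>
      ENNReal.ofReal |(dilationMatrix B l q.1 q.2).det| * G (dualOrbit B l q.1 q.2 ξ) :=
    hdet.mul horb
  have hmul : Measurable fun a : ℝ => ξ 0 * a := measurable_const_mul _
  have hgm : Measurable fun a : ℝ => g (ξ 0 * a) := hg.comp hmul
  calc ∫⁻ q, ENNReal.ofReal |(dilationMatrix B l q.1 q.2).det| * G (dualOrbit B l q.1 q.2 ξ)
        ∂((volume : Measure (Fin n → ℝ)).prod (scaleMeasure (n + 1)))
      = ∫⁻ a, ∫⁻ s : Fin n → ℝ, ENNReal.ofReal |(dilationMatrix B l s a).det| *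
          G (dualOrbit B l s a ξ) ∂volume ∂scaleMeasure (n + 1) :=
        lintegral_prod_symm' _ hdo
    _ = ∫⁻ a, ENNReal.ofReal (|a| * (|ξ 0| ^ n)⁻¹) * g (ξ 0 * a) ∂scaleMeasure (n + 1) := by
        refine lintegral_congr_ae ?_
        filter_upwards [ae_ne_zero_scaleMeasure (n + 1)] with a ha using
          lintegral_dualOrbit_shear hB hG hξ ha
    _ = ∫⁻ a, ENNReal.ofReal (|ξ 0| ^ n)⁻¹ * (ENNReal.ofReal (|a| ^ (n + 1))⁻¹ * g (ξ 0 * a)) := by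
        have hm : Measurable fun a : ℝ =>
            ENNReal.ofReal (|a| * (|ξ 0| ^ n)⁻¹) * g (ξ 0 * a) :=
          Measurable.mul (by fun_prop) hgm
        rw [lintegral_scaleMeasure _ hm]
        refine lintegral_congr_ae ?_
        filter_upwards [hne] with a ha
        have hap : 0 < |a| := abs_pos.2 ha
        rw [← mul_assoc, ← mul_assoc, ← ENNReal.ofReal_mul (by positivity),
          ← ENNReal.ofReal_mul (by positivity)]
        congr 2
        field_simp
        ring
    _ = ENNReal.ofReal (|ξ 0| ^ n)⁻¹ * ∫⁻ a, g (ξ 0 * a) ∂scaleMeasure n := by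
        rw [lintegral_const_mul' _ _ ENNReal.ofReal_ne_top,
          lintegral_scaleMeasure n hgm]
    _ = ∫⁻ a, g a ∂scaleMeasure n := by
        rw [← lintegral_map hg hmul, map_mul_scaleMeasure n hξ, lintegral_smul_measure, smul_eq_mul,
          ← mul_assoc, ← ENNReal.ofReal_mul (by positivity), inv_mul_cancel₀ (by positivity),
          ENNReal.ofReal_one, one_mul]
    _ = ∫⁻ x, ∫⁻ y : Fin n → ℝ, G (consVec x y) / ‖(consVec x y) 0‖ₑ ^ (n + 1) := by
        rw [lintegral_scaleMeasure n hg]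
        refine lintegral_congr_ae ?_
        filter_upwards [hne] with x hx
        have h0 : ∀ y : Fin n → ℝ, (consVec x y) 0 = x := fun y => rfl
        have hxp : 0 < |x| := abs_pos.2 hx
        have hxe : (‖x‖ₑ ^ (n + 1))⁻¹ = ENNReal.ofReal (|x| ^ (n + 1))⁻¹ := by
          rw [ENNReal.ofReal_inv_of_pos (by positivity), ENNReal.ofReal_pow (abs_nonneg _),
            Real.enorm_eq_ofReal_abs]
        simp only [h0, div_eq_mul_inv, hxe]
        rw [lintegral_mul_const' _ _ ENNReal.ofReal_ne_top, mul_comm]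
    _ = ∫⁻ η, G η / ‖η 0‖ₑ ^ (n + 1) := by
        exact (lintegral_eq_lintegral_consVec hGd).symm

end OrbitIntegral

/-! ### Orthogonality relations, irreducibility and admissible vectors -/

section Main

variable {n : ℕ} {B : (Fin n → ℝ) → Matrix (Fin n) (Fin n) ℝ} {l : Fin n → ℝ}
  {H : Subgroup (GL (Fin (n + 1)) ℝ)}

lemma act_transposeGL_eq_dualOrbit {h : GL (Fin (n + 1)) ℝ} {s : Fin n → ℝ} {a : ℝ}
    (hh : (h : Matrix (Fin (n + 1)) (Fin (n + 1)) ℝ) = dilationMatrix B l s a)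
    (ξ : EuclideanSpace ℝ (Fin (n + 1))) : act (transposeGL h) ξ = dualOrbit B l s a ξ := by
  rw [act, coe_transposeGL, hh, dualOrbit, Matrix.toLpLin_apply]

lemma measurable_coeFn (φ : L2 (n + 1)) : Measurable φ := (Lp.stronglyMeasurable φ).measurable

lemma lintegral_enorm_sq_fourier (f : L2 (n + 1)) :
    ∫⁻ ξ, ‖(𝓕 f : L2 (n + 1)) ξ‖ₑ ^ 2 = ‖f‖ₑ ^ 2 := by
  rw [lintegral_enorm_sq, ← Lp.enorm_def, ← ofReal_norm, ← ofReal_norm, Lp.norm_fourier_eq]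

lemma ae_apply_zero_ne_zero :
    ∀ᵐ ξ : EuclideanSpace ℝ (Fin (n + 1)), ξ 0 ≠ 0 := by
  have h0 : Measurable fun η : EuclideanSpace ℝ (Fin (n + 1)) => η 0 :=
    (measurable_pi_apply 0).comp (WithLp.measurable_ofLp 2 _)
  have hm : MeasurableSet {ξ : EuclideanSpace ℝ (Fin (n + 1)) | ¬ ξ 0 ≠ 0} :=
    (h0 (measurableSet_singleton 0).compl).compl
  rw [ae_iff, ← lintegral_indicator_one hm,
    lintegral_eq_lintegral_consVec (measurable_one.indicator hm)]
  refine (lintegral_congr_ae ?_).trans lintegral_zero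
  have hne : ∀ᵐ a : ℝ, a ≠ 0 := by simp [ae_iff]
  filter_upwards [hne] with x hx
  refine (lintegral_congr fun y => ?_).trans lintegral_zero
  refine Set.indicator_of_notMem ?_ _
  have : (consVec x y) 0 = x := rfl
  simpa [this] using hx

namespace IsShearletPresentation

/-- The orthogonality relation `∫ |⟨f, π(g)ψ⟩|² dg = C_ψ ‖f‖²`, with values in `[0, ∞]`. -/
theorem lintegral_voice (hP : IsShearletPresentation B l H) (ψ f : L2 (n + 1)) :
    ∫⁻ g, ‖voice (quasiRegular H) ψ f g‖ₑ ^ 2 ∂hP.haar =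
      admissibilityConstant ψ * ‖f‖ₑ ^ 2 := by
  have := hP.secondCountableTopology
  have hemb := hP.measurableEmbedding_coord
  set ψh : EuclideanSpace ℝ (Fin (n + 1)) → ℂ := ⇑(𝓕 ψ : L2 (n + 1))
  set fh : EuclideanSpace ℝ (Fin (n + 1)) → ℂ := ⇑(𝓕 f : L2 (n + 1))
  have hψm : Measurable ψh := measurable_coeFn _
  have hfm : Measurable fh := measurable_coeFn _
  -- the squared voice transform as a function of the coordinates
  let lin : (Fin n → ℝ) × ℝ → GL (Fin (n + 1)) ℝ := fun q =>
    if hq : q.2 ≠ 0 then Matrix.GeneralLinearGroup.mkOfDetNeZero (dilationMatrix B l q.1 q.2)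
      (hP.cocycle.det_dilationMatrix_ne_zero _ hq) else 1
  have hlin : ∀ q, q.2 ≠ 0 → (lin q : Matrix (Fin (n + 1)) (Fin (n + 1)) ℝ) =
      dilationMatrix B l q.1 q.2 := fun q hq => by
    simp only [lin, dif_pos hq]; rfl
  let φ : Coord n → ℝ≥0∞ := fun p => ‖𝓕⁻ (voiceSymbol (lin p.2) ψ f) p.1‖ₑ ^ 2
  have hφ : ∀ g : AffineGroup H, ‖voice (quasiRegular H) ψ f g‖ₑ ^ 2 = φ (coord l g) := by
    intro g
    obtain ⟨ha, hg⟩ := hP.lin_eq g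
    have h1 : AffineGroup.lin g = lin (coord l g).2 := Units.ext (hg.trans (hlin _ ha).symm)
    rw [voice_eq_fourierInv, h1]
    rfl
  have hvoice : Continuous fun g : AffineGroup H => voice (quasiRegular H) ψ f g :=
    (continuous_quasiRegular ψ).inner continuous_const
  have hφm : AEMeasurable φ (coordMeasure n) := by
    rw [← hP.map_coord_haar, hemb.aemeasurable_map_iff]
    have : φ ∘ coord l = fun g : AffineGroup H => ‖voice (quasiRegular H) ψ f g‖ₑ ^ 2 :=
      funext fun g => (hφ g).symm
    rw [this]
    exact (hvoice.measurable.enorm.pow_const 2).aemeasurable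
  let K : (Fin n → ℝ) × ℝ → EuclideanSpace ℝ (Fin (n + 1)) → ℝ≥0∞ := fun q ξ =>
    ENNReal.ofReal |(dilationMatrix B l q.1 q.2).det| * ‖ψh (dualOrbit B l q.1 q.2 ξ)‖ₑ ^ 2 *
      ‖fh ξ‖ₑ ^ 2
  have hKm : Measurable (Function.uncurry K) := by
    have h1 : Measurable fun p : ((Fin n → ℝ) × ℝ) × EuclideanSpace ℝ (Fin (n + 1)) =>
        ENNReal.ofReal |(dilationMatrix B l p.1.1 p.1.2).det| := by
      simp only [hP.cocycle.det_dilationMatrix]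
      fun_prop
    have h2 : Measurable fun p : ((Fin n → ℝ) × ℝ) × EuclideanSpace ℝ (Fin (n + 1)) =>
        ψh (dualOrbit B l p.1.1 p.1.2 p.2) :=
      hψm.comp (measurable_dualOrbit (l := l) hP.cocycle)
    have h3 : Measurable fun p : ((Fin n → ℝ) × ℝ) × EuclideanSpace ℝ (Fin (n + 1)) => fh p.2 :=
      hfm.comp measurable_snd
    exact (h1.mul (h2.enorm.pow_const 2)).mul (h3.enorm.pow_const 2)
  have hne : ∀ᵐ q ∂((volume : Measure (Fin n → ℝ)).prod (scaleMeasure (n + 1))), q.2 ≠ 0 :=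
    Measure.quasiMeasurePreserving_snd.ae (ae_ne_zero_scaleMeasure (n + 1))
  have hG : Measurable fun η => ‖ψh η‖ₑ ^ 2 := hψm.enorm.pow_const 2
  calc ∫⁻ g, ‖voice (quasiRegular H) ψ f g‖ₑ ^ 2 ∂hP.haar
      = ∫⁻ p, φ p ∂coordMeasure n := by
        rw [← hP.map_coord_haar, hemb.lintegral_map]
        exact lintegral_congr hφ
    _ = ∫⁻ q, ∫⁻ b, φ (b, q) ∂volume
          ∂((volume : Measure (Fin n → ℝ)).prod (scaleMeasure (n + 1))) :=
        lintegral_prod_symm φ hφm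
    _ = ∫⁻ q, ∫⁻ ξ, K q ξ ∂volume
          ∂((volume : Measure (Fin n → ℝ)).prod (scaleMeasure (n + 1))) := by
        refine lintegral_congr_ae ?_
        filter_upwards [hne] with q hq
        have h1 := lintegral_fourierInv_voiceSymbol (lin q) ψ f
        simp only [act_transposeGL_eq_dualOrbit (hlin q hq), hlin q hq] at h1
        exact h1
    _ = ∫⁻ ξ, ∫⁻ q, K q ξ ∂((volume : Measure (Fin n → ℝ)).prod (scaleMeasure (n + 1))) :=
        lintegral_lintegral_swap hKm.aemeasurable
    _ = ∫⁻ ξ, admissibilityConstant ψ * ‖fh ξ‖ₑ ^ 2 := by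
        refine lintegral_congr_ae ?_
        filter_upwards [ae_apply_zero_ne_zero] with ξ hξ
        rw [lintegral_mul_const' _ _ (by finiteness),
          lintegral_dualOrbit hP.cocycle hG hξ]
        rfl
    _ = admissibilityConstant ψ * ‖f‖ₑ ^ 2 := by
        rw [lintegral_const_mul _ (hfm.enorm.pow_const 2), lintegral_enorm_sq_fourier]

end IsShearletPresentation

lemma admissibilityConstant_pos_iff (ψ : L2 (n + 1)) : 0 < admissibilityConstant ψ ↔ ψ ≠ 0 := by
  have hm : Measurable fun ξ : EuclideanSpace ℝ (Fin (n + 1)) =>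
      ‖(𝓕 ψ : L2 (n + 1)) ξ‖ₑ ^ 2 / ‖ξ 0‖ₑ ^ (n + 1) := by
    have h0 : Measurable fun η : EuclideanSpace ℝ (Fin (n + 1)) => η 0 :=
      (measurable_pi_apply 0).comp (WithLp.measurable_ofLp 2 _)
    exact ((measurable_coeFn _).enorm.pow_const 2).div (h0.enorm.pow_const _)
  rw [pos_iff_ne_zero, not_iff_not, admissibilityConstant, lintegral_eq_zero_iff hm]
  constructor
  · intro h
    have h1 : (𝓕 ψ : L2 (n + 1)) = 0 := by
      refine (Lp.eq_zero_iff_ae_eq_zero).2 ?_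
      filter_upwards [h] with ξ hξ
      have h2 : ‖ξ 0‖ₑ ^ (n + 1) ≠ ⊤ := by finiteness
      simpa [ENNReal.div_eq_zero_iff, h2] using hξ
    rw [← norm_eq_zero, Lp.norm_fourier_eq, norm_eq_zero] at h1
    exact h1
  · rintro rfl
    have h1 : (𝓕 (0 : L2 (n + 1)) : L2 (n + 1)) = 0 := by
      rw [← norm_eq_zero, Lp.norm_fourier_eq, norm_zero]
    rw [h1]
    exact Filter.Eventually.of_forall fun ξ => by simp

/-- A function whose Fourier transform is the indicator of a ball away from the hyperplane
`ξ₁ = 0` is admissible. -/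
lemma exists_admissibilityConstant_lt_top :
    ∃ ψ : L2 (n + 1), 0 < admissibilityConstant ψ ∧ admissibilityConstant ψ < ⊤ := by
  let c : EuclideanSpace ℝ (Fin (n + 1)) := EuclideanSpace.single 0 2
  have hfin : volume (Metric.ball c 1) ≠ ⊤ := measure_ball_lt_top.ne
  let φ : L2 (n + 1) := indicatorConstLp 2 (measurableSet_ball (x := c) (ε := 1)) hfin (1 : ℂ)
  have hφ : (𝓕 (𝓕⁻ φ : L2 (n + 1)) : L2 (n + 1)) = φ := FourierTransform.fourier_fourierInv_eq φ
  have hae : φ =ᵐ[volume] (Metric.ball c 1).indicator fun _ => (1 : ℂ) := indicatorConstLp_coeFn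
  refine ⟨𝓕⁻ φ, ?_, ?_⟩
  · rw [admissibilityConstant_pos_iff]
    intro h0
    have h1 : φ = 0 := by
      rw [← hφ, ← norm_eq_zero, Lp.norm_fourier_eq, h0, norm_zero]
    have h2 : volume (Metric.ball c 1) = 0 := by
      have h3 : eLpNorm φ 2 volume = 0 := by
        rw [h1, eLpNorm_congr_ae (Lp.coeFn_zero ℂ 2 _), eLpNorm_zero]
      rw [eLpNorm_congr_ae hae, eLpNorm_indicator_const measurableSet_ball (by norm_num)
        (by norm_num)] at h3
      simpa [hfin] using h3
    exact (Metric.measure_ball_pos volume c one_pos).ne' h2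
  · rw [admissibilityConstant, hφ]
    refine lt_of_le_of_lt (lintegral_mono_ae (g := (Metric.ball c 1).indicator 1) ?_) ?_
    · filter_upwards [hae] with ξ hξ
      rw [hξ]
      by_cases hb : ξ ∈ Metric.ball c 1
      · rw [Set.indicator_of_mem hb, Set.indicator_of_mem hb]
        have h1 : ‖ξ 0 - 2‖ < 1 := by
          have h2 := PiLp.norm_apply_le (ξ - c) 0
          rw [Metric.mem_ball, dist_eq_norm] at hb
          refine lt_of_le_of_lt ?_ hb
          simpa [c] using h2
        have h2 : 1 ≤ ‖ξ 0‖ₑ := by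
          rw [Real.enorm_eq_ofReal_abs, ENNReal.one_le_ofReal]
          rw [Real.norm_eq_abs, abs_lt] at h1
          rw [abs_of_pos (by linarith)]
          linarith
        simp only [enorm_one, one_pow, Pi.one_apply]
        exact ENNReal.div_le_of_le_mul (by simpa using one_le_pow₀ h2)
      · rw [Set.indicator_of_notMem hb, Set.indicator_of_notMem hb]
        simp
    · rw [lintegral_indicator_one measurableSet_ball]
      exact lt_top_iff_ne_top.2 hfin

namespace IsShearletPresentation

lemma aestronglyMeasurable_voice (hP : IsShearletPresentation B l H) (μ : Measure (AffineGroup H))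
    (ψ f : L2 (n + 1)) : AEStronglyMeasurable (voice (quasiRegular H) ψ f) μ := by
  have := hP.secondCountableTopology
  have h : Continuous fun g : AffineGroup H => voice (quasiRegular H) ψ f g :=
    (continuous_quasiRegular ψ).inner continuous_const
  exact h.aestronglyMeasurable

lemma eLpNorm_voice_sq (hP : IsShearletPresentation B l H) {μ : Measure (AffineGroup H)} {c : ℝ≥0}
    (hμ : μ = c • hP.haar) (ψ f : L2 (n + 1)) :
    eLpNorm (voice (quasiRegular H) ψ f) 2 μ ^ 2 = c * admissibilityConstant ψ * ‖f‖ₑ ^ 2 := by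
  rw [← lintegral_enorm_sq, hμ, ← Measure.coe_nnreal_smul, lintegral_smul_measure,
    hP.lintegral_voice, mul_assoc]
  rfl

lemma isTopIrreducible (hP : IsShearletPresentation B l H) : IsTopIrreducible (quasiRegular H) := by
  obtain ⟨ψ₀, hψ₀, -⟩ := exists_admissibilityConstant_lt_top (n := n)
  refine ⟨⟨ψ₀, 0, (admissibilityConstant_pos_iff ψ₀).1 hψ₀⟩, fun W hW hinv => ?_⟩
  refine or_iff_not_imp_left.2 fun hne => ?_
  obtain ⟨w, hwW, hw0⟩ := (Submodule.ne_bot_iff W).1 hne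
  have : CompleteSpace W := hW.completeSpace_coe
  rw [← Submodule.orthogonal_eq_bot_iff, Submodule.eq_bot_iff]
  intro f hf
  -- the voice transform of `f` vanishes, hence so does `C_w ‖f‖²`
  have h0 : ∀ g : AffineGroup H, voice (quasiRegular H) w f g = 0 := fun g =>
    (Submodule.mem_orthogonal W f).1 hf _ (hinv g w hwW)
  have h1 := hP.lintegral_voice w f
  simp only [h0, enorm_zero, ne_eq, OfNat.ofNat_ne_zero, not_false_eq_true, zero_pow,
    lintegral_zero] at h1
  have h2 := (mul_eq_zero.1 h1.symm).resolve_left ((admissibilityConstant_pos_iff w).2 hw0).ne'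
  simpa using h2

lemma isAdmissible_iff (hP : IsShearletPresentation B l H) (μ : Measure (AffineGroup H))
    [μ.IsHaarMeasure] (ψ : L2 (n + 1)) : IsAdmissible (quasiRegular H) μ ψ ↔
      0 < admissibilityConstant ψ ∧ admissibilityConstant ψ < ⊤ := by
  obtain ⟨c, hc, hμ⟩ := hP.exists_eq_smul_haar μ
  rw [IsAdmissible, admissibilityConstant_pos_iff]
  refine and_congr_right fun hψ => ⟨fun h => ?_, fun h f =>
    ⟨hP.aestronglyMeasurable_voice μ ψ f, ?_⟩⟩
  · have h1 := hP.eLpNorm_voice_sq hμ ψ ψ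
    have h2 : eLpNorm (voice (quasiRegular H) ψ ψ) 2 μ ^ 2 < ⊤ := ENNReal.pow_lt_top (h ψ).2
    by_contra htop
    rw [not_lt, top_le_iff] at htop
    rw [h1, htop, ENNReal.mul_top (by simpa using hc), ENNReal.top_mul (by simpa using hψ)] at h2
    exact lt_irrefl _ h2
  · have h1 := hP.eLpNorm_voice_sq hμ ψ f
    have h2 : eLpNorm (voice (quasiRegular H) ψ f) 2 μ ^ 2 < ⊤ := by
      rw [h1]
      exact ENNReal.mul_lt_top (ENNReal.mul_lt_top ENNReal.coe_lt_top h)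
        (ENNReal.pow_lt_top enorm_lt_top)
    exact (ENNReal.pow_lt_top_iff.1 h2).resolve_right (by norm_num)

lemma exists_eLpNorm_voice_eq (hP : IsShearletPresentation B l H) (μ : Measure (AffineGroup H))
    [μ.IsHaarMeasure] {ψ : L2 (n + 1)} (hψ : IsAdmissible (quasiRegular H) μ ψ) :
    ∃ c : ℝ≥0, 0 < c ∧ ∀ f : L2 (n + 1),
      eLpNorm (voice (quasiRegular H) ψ f) 2 μ = c * ‖f‖ₑ := by
  obtain ⟨c, hc, hμ⟩ := hP.exists_eq_smul_haar μ
  obtain ⟨hpos, htop⟩ := (hP.isAdmissible_iff μ ψ).1 hψ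
  lift admissibilityConstant ψ to ℝ≥0 using htop.ne with C hC
  have hC0 : 0 < C := by simpa using hpos
  refine ⟨NNReal.sqrt (c * C), NNReal.sqrt_pos.2 (mul_pos (pos_iff_ne_zero.2 hc) hC0), fun f => ?_⟩
  have h1 := hP.eLpNorm_voice_sq hμ ψ f
  rw [← hC, ← ENNReal.coe_mul, ← NNReal.sq_sqrt (c * C), ENNReal.coe_pow, ← mul_pow] at h1
  exact (ENNReal.pow_right_strictMono two_ne_zero).injective h1

end IsShearletPresentation

end Main

end Shearlet

end

theorem theorem2p2 {n : ℕ} (H : Subgroup (GL (Fin (n + 1)) ℝ))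
    (hH : Shearlet.IsShearletDilationGroup H)
    (μ : Measure (Shearlet.AffineGroup H)) [μ.IsHaarMeasure] :
    Shearlet.IsSquareIntegrable (Shearlet.quasiRegular H) μ ∧
    (∀ ψ : Shearlet.L2 (n + 1), Shearlet.IsAdmissible (Shearlet.quasiRegular H) μ ψ ↔
      0 < Shearlet.admissibilityConstant ψ ∧ Shearlet.admissibilityConstant ψ < ⊤) ∧
    (∀ ψ : Shearlet.L2 (n + 1), Shearlet.IsAdmissible (Shearlet.quasiRegular H) μ ψ →
      ∃ c : ℝ≥0, 0 < c ∧ ∀ f : Shearlet.L2 (n + 1),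
        eLpNorm (Shearlet.voice (Shearlet.quasiRegular H) ψ f) 2 μ = c * ‖f‖ₑ) := by
  obtain ⟨B, l, hP⟩ := hH.exists_presentation
  have := hP.secondCountableTopology
  obtain ⟨ψ, hψ⟩ := Shearlet.exists_admissibilityConstant_lt_top (n := n)
  exact ⟨⟨Shearlet.continuous_quasiRegular, hP.isTopIrreducible, ψ, (hP.isAdmissible_iff μ ψ).2 hψ⟩,
    hP.isAdmissible_iff μ, fun _ => hP.exists_eLpNorm_voice_eq μ⟩
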